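/- Let $(\Omega,\mathcal F,\mathbb P)$ be a probability space and let $L^0$ be the ring of classes of real random variables modulo a.e. equality, ordered by a.e. dominance; suprema in $L^0$ are essential suprema, and $<$ between measurable functions means strict inequality a.e.; $L^0_{++}=\{r\in L^0: r>0\}$. Let $L^0_s(\mathbb N)$ be the set of classes of measurable functions $\Omega\to\mathbb N$, directed by the a.e. order. A *partition* is a countable measurable partition $(A_k)$ of $\Omega$. Let $E$ be a stable $L^0$-module: for every partition $(A_k)$ and every sequence $(x_k)$ in $E$ there is a unique $x\in E$, written $\sum_k 1_{A_k}x_k$ and called the concatenation, with $1_{A_k}x=1_{A_k}x_k$ for all $k$. Concatenations in $L^0_s(\mathbb N)$, and of functions $E\to L^0$ (pointwise), are defined likewise. A set is *stable* if it is nonempty and closed under concatenations; a function is stable if it commutes with concatenations; a collection $\mathscr Y$ of stable sets is a *stable collection* if it is nonempty and $\{\sum_k1_{A_k}y_k: y_k\in Y_k\}\in\mathscr Y$ for all partitions $(A_k)$ and $Y_k\in\mathscr Y$. A stable set is *stable finite* if it is the image of $\{m\in L^0_s(\mathbb N):1\le m\le n\}$ under a stable bijection for some $n\in L^0_s(\mathbb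 N)$. Let $\|\cdot\|:E\to L^0_+$ be an $L^0$-norm, that is, $\|rx\|=|r|\,\|x\|$, $\|x+y\|\le\|x\|+\|y\|$, and $\|x\|=0$ only if $x=0$. For a set $\mathscr P$ of functions $E\to L^0_+$ (here always $L^0$-seminorms), let $\mathscr T_0(\mathscr P)$ (respectively, $\mathscr T_s(\mathscr P)$) be the topology on $E$ generated by the sets $\{y\in E:\sup_{p\in N}p(x-y)<r\}$, where $x\in E$, $r\in L^0_{++}$ and $N\subset\mathscr P$ is nonempty finite (respectively, stable finite). Let $E^*$ be the set of $L^0$-linear functions $E\to L^0$ that are continuous from $\mathscr T_0(\{\|\cdot\|\})$ to the topology $\mathscr T_0(\{|\cdot|\})$ on $L^0$. Let $\sigma_0(E,E^*)=\mathscr T_0(\{|f(\cdot)|:f\in E^*\})$ and $\sigma_s(E,E^*)=\mathscr T_s(\{|f(\cdot)|:f\in E^*\})$. Let $S\subset E$ be stable. A filter on $S$ is *stable* if it has a filter base which is a stable collection of stable subsets of $S$, and $S$ is *stable compact* for a topology if every stable filter on $S$ has a cluster point in $S$. A *stable sequence* in $S$ is a stable function $L^0_s(\mathbb N)\to S$,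 $n\mapsto x_n$. A *stable subsequence* of it is a family $(x_{n_k})_{k\in L^0_s(\mathbb N)}$, where $k\mapsto n_k$ is a stable function $L^0_s(\mathbb N)\to L^0_s(\mathbb N)$ with $n_k<n_l$ whenever $k<l$. Convergence is convergence as a net indexed by $L^0_s(\mathbb N)$. **Theorem.** For every such $E$, $\|\cdot\|$ and stable $S\subset E$, the following are equivalent: (i) $S$ is stable $\sigma_s(E,E^*)$-compact. (ii) Every stable sequence in $S$ has a stable subsequence which converges to an element of $S$ with respect to $\sigma_0(E,E^*)$. (iii) Every stable sequence in $S$ has a stable subsequence which converges to an element of $S$ with respect to $\sigma_s(E,E^*)$. -/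

import Mathlib

open MeasureTheory Filter

/-! Modules over `L⁰`, stability under countable concatenations, the topologies induced by
`L⁰`-seminorms, stable compactness and stable sequences. -/

namespace L0Mod

/-- The ring `L⁰` of (classes of) real random variables; its order is a.e. dominance. -/
abbrev L0 {Ω : Type*} [MeasurableSpace Ω] (P : Measure Ω) := Ω →ₘ[P] ℝ

/-- Pointwise a.e. operations make `L⁰` a commutative ring. -/
noncomputable instance instCommRingL0 {Ω : Type*} [MeasurableSpace Ω] (P : Measure Ω) :
    CommRing (L0 P) where
  __ := (inferInstance : AddCommGroup (L0 P))
  __ := (inferInstance : CommMonoid (L0 P))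
  left_distrib f g h := by
    induction f, g, h using AEEqFun.induction_on₃ with
    | _ f hf g hg h hh => simp only [AEEqFun.mk_add_mk, AEEqFun.mk_mul_mk, mul_add]
  right_distrib f g h := by
    induction f, g, h using AEEqFun.induction_on₃ with
    | _ f hf g hg h hh => simp only [AEEqFun.mk_add_mk, AEEqFun.mk_mul_mk, add_mul]
  zero_mul f := by
    induction f using AEEqFun.induction_on with
    | _ f hf => simp only [AEEqFun.zero_def, AEEqFun.mk_mul_mk, Pi.mul_def, zero_mul]
  mul_zero f := by
    induction f using AEEqFun.induction_on with
    | _ f hf => simp only [AEEqFun.zero_def, AEEqFun.mk_mul_mk, Pi.mul_def, mul_zero]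

/-- `L⁰_s(ℕ)`: the (classes of) measurable functions with values in `ℕ`. -/
abbrev L0Nat {Ω : Type*} [MeasurableSpace Ω] (P : Measure Ω) := Ω →ₘ[P] ℕ

/-- Measurable sets. -/
abbrev Event (Ω : Type*) [MeasurableSpace Ω] := {A : Set Ω // MeasurableSet A}

/-- The indicator function `1_A` as an element of `L⁰`. -/
noncomputable def ind {Ω : Type*} [MeasurableSpace Ω] (P : Measure Ω) (A : Event Ω) : L0 P :=
  AEEqFun.mk (A.1.indicator fun _ => (1 : ℝ)) (aestronglyMeasurable_const.indicator A.2)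

/-- Strict inequality almost everywhere (the relation `<` of the partial order on classes is
weaker). -/
def AELt {Ω β : Type*} [MeasurableSpace Ω] {P : Measure Ω} [TopologicalSpace β] [LT β]
    (f g : Ω →ₘ[P] β) : Prop :=
  ∀ᵐ ω ∂P, f ω < g ω

/-- Countable measurable partitions of `Ω` (finite ones are padded with empty sets). -/
structure Partition (Ω : Type*) [MeasurableSpace Ω] where
  part : ℕ → Event Ω
  disjoint : ∀ i j, i ≠ j → Disjoint (part i).1 (part j).1
  cover : ⋃ k, (part k).1 = Set.univ

section Generic

/-! In this section `R A x y` is to be read as `x|A = y|A`. -/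

variable {Ω X Y : Type*} [MeasurableSpace Ω]

/-- `z` is the concatenation of `(x k)` along the partition `A`. -/
def IsConcat (R : Event Ω → X → X → Prop) (A : Partition Ω) (x : ℕ → X) (z : X) : Prop :=
  ∀ k, R (A.part k) z (x k)

/-- Stable sets: nonempty and closed under countable concatenations. -/
def IsStableSet (R : Event Ω → X → X → Prop) (S : Set X) : Prop :=
  S.Nonempty ∧ ∀ (A : Partition Ω) (x : ℕ → X) (z : X),
    (∀ k, x k ∈ S) → IsConcat R A x z → z ∈ S

/-- The set `∑ Y_k | A_k` of all concatenations of elements `y k ∈ Y_k`. -/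
def concatSet (R : Event Ω → X → X → Prop) (A : Partition Ω) (Z : ℕ → Set X) : Set X :=
  {z | ∃ y : ℕ → X, (∀ k, y k ∈ Z k) ∧ IsConcat R A y z}

/-- Stable collections of stable sets. -/
def IsStableCollection (R : Event Ω → X → X → Prop) (𝒴 : Set (Set X)) : Prop :=
  𝒴.Nonempty ∧ (∀ Z ∈ 𝒴, IsStableSet R Z) ∧
    ∀ (A : Partition Ω) (Z : ℕ → Set X), (∀ k, Z k ∈ 𝒴) → concatSet R A Z ∈ 𝒴

/-- `f` commutes with concatenations of elements of `D`. -/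
def IsStableOn (R : Event Ω → X → X → Prop) (R' : Event Ω → Y → Y → Prop) (f : X → Y)
    (D : Set X) : Prop :=
  ∀ (A : Partition Ω) (x : ℕ → X) (z : X), (∀ k, x k ∈ D) → z ∈ D →
    IsConcat R A x z → IsConcat R' A (fun k => f (x k)) (f z)

end Generic

section Relations

variable {Ω : Type*} [MeasurableSpace Ω] (P : Measure Ω)
  (E : Type*) [AddCommGroup E] [Module (L0 P) E]

/-- `x|A = y|A` in an `L⁰`-module. -/
def ModEq (A : Event Ω) (x y : E) : Prop := ind P A • x = ind P A • y

/-- `m|A = n|A` in `L⁰_s(ℕ)`. -/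
def NatEq (A : Event Ω) (m n : L0Nat P) : Prop := ∀ᵐ ω ∂P, ω ∈ A.1 → m ω = n ω

/-- `p|A = q|A`, i.e. `1_A p = 1_A q`, for functions `E → L⁰`. -/
def FunEq (A : Event Ω) (p q : E → L0 P) : Prop := ∀ x, ind P A * p x = ind P A * q x

/-- Stable `L⁰`-modules: unique countable concatenations exist. -/
def IsStableModule : Prop :=
  ∀ (A : Partition Ω) (x : ℕ → E), ∃! z : E, IsConcat (ModEq P E) A x z

end Relations

section Topologies

variable {Ω : Type*} [MeasurableSpace Ω] {P : Measure Ω}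
  {E : Type*} [AddCommGroup E] [Module (L0 P) E]

/-- `L⁰`-norms. -/
structure IsL0Norm (N : E → L0 P) : Prop where
  nonneg : ∀ x, 0 ≤ N x
  smul : ∀ (r : L0 P) (x : E), N (r • x) = |r| * N x
  add_le : ∀ x y, N (x + y) ≤ N x + N y
  eq_zero : ∀ x, N x = 0 → x = 0

/-- `{1 ≤ m ≤ n}` in `L⁰_s(ℕ)`. -/
def natInterval (n : L0Nat P) : Set (L0Nat P) := {m | 1 ≤ m ∧ m ≤ n}

/-- Stable finite sets of functions `E → L⁰`: stable sets in stable bijection with some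
`{1 ≤ m ≤ n}`. -/
def IsStableFinite (𝒩 : Set (E → L0 P)) : Prop :=
  IsStableSet (FunEq P E) 𝒩 ∧ ∃ (n : L0Nat P) (φ : L0Nat P → (E → L0 P)),
    Set.BijOn φ (natInterval n) 𝒩 ∧ IsStableOn (NatEq P) (FunEq P E) φ (natInterval n)

/-- `{y | sup_{p ∈ 𝒩} p (x - y) < r}`, where the supremum is the essential supremum, that is,
the least upper bound in `L⁰`. -/
def seminormBall (x : E) (𝒩 : Set (E → L0 P)) (r : L0 P) : Set E :=
  {y | ∃ s : L0 P, IsLUB ((fun p => p (x - y)) '' 𝒩) s ∧ AELt s r}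

/-- The `L⁰`-topology `𝒯₀(𝒬)`, with finite subfamilies. -/
@[reducible] def topZero (𝒬 : Set (E → L0 P)) : TopologicalSpace E :=
  TopologicalSpace.generateFrom
    {U | ∃ (x : E) (𝒩 : Set (E → L0 P)) (r : L0 P),
      𝒩 ⊆ 𝒬 ∧ 𝒩.Finite ∧ 𝒩.Nonempty ∧ AELt 0 r ∧ U = seminormBall x 𝒩 r}

/-- The stable topology `𝒯_s(𝒬)`, with stable finite subfamilies. -/
@[reducible] def topStable (𝒬 : Set (E → L0 P)) : TopologicalSpace E :=
  TopologicalSpace.generateFrom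
    {U | ∃ (x : E) (𝒩 : Set (E → L0 P)) (r : L0 P),
      𝒩 ⊆ 𝒬 ∧ IsStableFinite 𝒩 ∧ AELt 0 r ∧ U = seminormBall x 𝒩 r}

/-- The dual module `E*`: `L⁰`-linear functions `E → L⁰` that are continuous for the topologies
induced by the `L⁰`-norm `N` and by the absolute value. -/
def dual (N : E → L0 P) : Set (E →ₗ[L0 P] L0 P) :=
  {f | @Continuous E (L0 P) (topZero {N}) (topZero {fun r : L0 P => |r|}) f}

/-- The seminorms `|⟨·, f⟩|`, `f ∈ E*`. -/
def weakSeminorms (N : E → L0 P) : Set (E → L0 P) :=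
  {p | ∃ f ∈ dual N, p = fun x => |f x|}

/-- The weak `L⁰`-topology `σ₀(E, E*)`. -/
@[reducible] def weakZero (N : E → L0 P) : TopologicalSpace E := topZero (weakSeminorms N)

/-- The weak stable topology `σ_s(E, E*)`. -/
@[reducible] def weakStable (N : E → L0 P) : TopologicalSpace E := topStable (weakSeminorms N)

/-- A stable filter on `S`, seen as a filter on `E` that contains `S`: it has a filter base that
is a stable collection of stable subsets of `S`. -/
def IsStableFilterOn (S : Set E) (F : Filter E) : Prop :=
  ∃ ℬ : Set (Set E), IsStableCollection (ModEq P E) ℬ ∧ (∀ Z ∈ ℬ, Z ⊆ S) ∧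
    F.HasBasis (fun Z => Z ∈ ℬ) id

variable (P) in
/-- Stable compactness of `S`: every stable filter on `S` has a cluster point in `S`. -/
def IsStableCompact (T : TopologicalSpace E) (S : Set E) : Prop :=
  ∀ F : Filter E, IsStableFilterOn (P := P) S F → ∃ x ∈ S, @ClusterPt E T x F

/-- Stable sequences, i.e. stable functions `L⁰_s(ℕ) → E`. -/
def IsStableSeq (x : L0Nat P → E) : Prop :=
  IsStableOn (NatEq P) (ModEq P E) x Set.univ

/-- `y` is a stable subsequence of `x`: `y k = x (ν k)` for a (strictly) increasing stable
sequence `ν` in `L⁰_s(ℕ)`. -/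
def IsStableSubseq (y x : L0Nat P → E) : Prop :=
  ∃ ν : L0Nat P → L0Nat P, IsStableOn (NatEq P) (NatEq P) ν Set.univ ∧
    (∀ k l, AELt k l → AELt (ν k) (ν l)) ∧ ∀ k, y k = x (ν k)

variable (P) in
/-- Every stable sequence in `S` has a stable subsequence that converges in `S`, as a net indexed
by the directed set `L⁰_s(ℕ)`. -/
def IsStableSeqCompact (T : TopologicalSpace E) (S : Set E) : Prop :=
  ∀ x : L0Nat P → E, IsStableSeq x → (∀ n, x n ∈ S) →
    ∃ y : L0Nat P → E, IsStableSubseq y x ∧ ∃ z ∈ S, Tendsto y atTop (@nhds E T z)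

end Topologies

end L0Mod

open scoped Topology

/-! The conditional Eberlein–Šmulian theorem for `L⁰`-normed modules. -/

/-! The classical Eberlein–Šmulian argument is run ω by ω. In a stable module a sequence `x` can be
evaluated at a measurable random index `m`, and an `L⁰`-linear functional sees the result pointwise:
its value at ω is that of `f (x (m ω))` at ω (`IsLocal.cat`). So any measurable choice among
countably many elements is realised by an element of `E`. All three conditions are compared with
`IsRandomSeqCompact`: along strictly increasing random indices, each functional of the dual
converges a.e. to its value at a point of `S`. The null set may depend on the functional. A stable
neighbourhood involves only countably many functionals, finitely many at each ω, so stable sequences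
cannot distinguish the two weak topologies.

Compactness implies sequential compactness: put the sequence in a countable set `D` closed under
sums and rational multiples. Its random tails generate a stable filter, which yields a random
cluster point `z`. By Hahn–Banach `z` lies in the random closure of `D`, where functionals norming
`D` separate points (`eq_of_norming`). Choose random indices along which these countably many
functionals converge to their values at `z`. Random selections from arbitrarily late members of this
subsequence again have a cluster point, which must be `z`; hence every functional converges.

Sequential compactness implies compactness: functionals of the dual are bounded on `S`, and a
maximality argument assigns to each `f` in the dual ball a value `φ f` that is approximated, jointly
for finitely many `f`, on every base set of the filter (`exists_consistent_values`). This replaces a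
limit in the bidual. A closing-off argument in the style of Whitley then shows that `φ` is
evaluation at a point of `S` (`IsRandomSeqCompact.exists_eval_eq`), and this point is a cluster
point. -/

namespace L0Mod

/-! ### Pointwise calculus in `L⁰` and measurable selection -/

section Basic

variable {Ω : Type*} [MeasurableSpace Ω] {P : Measure Ω}

/-- Pointwise a.e. evaluation of the ring operations. -/
theorem coeFn_sub (a b : L0 P) : ∀ᵐ ω ∂P, (a - b) ω = a ω - b ω := AEEqFun.coeFn_sub a b

theorem coeFn_add (a b : L0 P) : ∀ᵐ ω ∂P, (a + b) ω = a ω + b ω := AEEqFun.coeFn_add a b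

theorem coeFn_mul (a b : L0 P) : ∀ᵐ ω ∂P, (a * b) ω = a ω * b ω := AEEqFun.coeFn_mul a b

theorem coeFn_neg (a : L0 P) : ∀ᵐ ω ∂P, (-a) ω = -a ω := AEEqFun.coeFn_neg a

theorem coeFn_abs (a : L0 P) : ∀ᵐ ω ∂P, (|a| : L0 P) ω = |a ω| := AEEqFun.coeFn_abs a

theorem coeFn_zero : ∀ᵐ ω ∂P, (0 : L0 P) ω = 0 := AEEqFun.coeFn_zero

theorem coeFn_one : ∀ᵐ ω ∂P, (1 : L0 P) ω = 1 := AEEqFun.coeFn_one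

theorem coeFn_cst {β : Type*} [TopologicalSpace β] (q : β) :
    ∀ᵐ ω ∂P, (AEEqFun.const Ω q : Ω →ₘ[P] β) ω = q := AEEqFun.coeFn_const (α := Ω) q

theorem le_iff_ae {β : Type*} [TopologicalSpace β] [Preorder β] {a b : Ω →ₘ[P] β} :
    a ≤ b ↔ ∀ᵐ ω ∂P, a ω ≤ b ω := AEEqFun.coeFn_le.symm

theorem eq_iff_ae {β : Type*} [TopologicalSpace β] {a b : Ω →ₘ[P] β} :
    a = b ↔ ∀ᵐ ω ∂P, a ω = b ω := ⟨fun h => by simp [h], fun h => AEEqFun.ext h⟩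

theorem coeFn_ind (A : Event Ω) : ∀ᵐ ω ∂P, ind P A ω = A.1.indicator (fun _ => (1 : ℝ)) ω :=
  AEEqFun.coeFn_mk _ _

instance instIsOrderedRingL0 : IsOrderedRing (L0 P) where
  add_le_add_left a b h c := by
    rw [le_iff_ae] at h ⊢
    filter_upwards [h, coeFn_add a c, coeFn_add b c] with ω h1 h2 h3
    rw [h2, h3]; linarith
  zero_le_one := by
    rw [le_iff_ae]
    filter_upwards [coeFn_zero (P := P), coeFn_one (P := P)] with ω h1 h2
    rw [h1, h2]; exact zero_le_one
  mul_le_mul_of_nonneg_left a ha b c h := by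
    rw [le_iff_ae] at h ha ⊢
    filter_upwards [h, ha, coeFn_mul a b, coeFn_mul a c, coeFn_zero (P := P)] with ω h1 h2 h3 h4 h5
    rw [h3, h4]
    exact mul_le_mul_of_nonneg_left h1 (by rwa [h5] at h2)
  mul_le_mul_of_nonneg_right a ha b c h := by
    rw [le_iff_ae] at h ha ⊢
    filter_upwards [h, ha, coeFn_mul b a, coeFn_mul c a, coeFn_zero (P := P)] with ω h1 h2 h3 h4 h5
    rw [h3, h4]
    exact mul_le_mul_of_nonneg_right h1 (by rwa [h5] at h2)

theorem measurable_coe (a : L0 P) : Measurable a := a.measurable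

theorem measurable_coe_nat (m : L0Nat P) : Measurable m := m.measurable

/-- Measurable selection of an index. -/
theorem exists_nat_select {p : ℕ → Ω → Prop} (hp : ∀ i, MeasurableSet {ω | p i ω})
    (h : ∀ᵐ ω ∂P, ∃ i, p i ω) : ∃ m : L0Nat P, ∀ᵐ ω ∂P, p (m ω) ω := by
  classical
  -- The second disjunct makes the search total: where no index qualifies, it stops at 0.
  have hex : ∀ ω, ∃ i, p i ω ∨ ∀ j, ¬ p j ω := fun ω => by
    by_cases hω : ∃ i, p i ω
    · exact hω.imp fun i hi => Or.inl hi
    · exact ⟨0, Or.inr (not_exists.mp hω)⟩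
  have hm : Measurable fun ω => Nat.find (hex ω) := by
    refine measurable_find hex fun k => ?_
    have : {ω | p k ω ∨ ∀ j, ¬ p j ω} = {ω | p k ω} ∪ ⋂ j, {ω | p j ω}ᶜ := by
      ext ω; simp
    rw [this]
    exact (hp k).union (MeasurableSet.iInter fun j => (hp j).compl)
  refine ⟨AEEqFun.mk _ hm.aestronglyMeasurable, ?_⟩
  filter_upwards [h, AEEqFun.coeFn_mk _ (hm.aestronglyMeasurable (μ := P))] with ω h1 h2
  rw [h2]
  rcases Nat.find_spec (hex ω) with h3 | h3
  · exact h3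
  · exact absurd h1 (not_exists.mpr h3)

/-- The partition of `Ω` into the level sets of `m`. -/
def levelPartition (m : L0Nat P) : Partition Ω where
  part k := ⟨m ⁻¹' {k}, measurable_coe_nat m (measurableSet_singleton k)⟩
  disjoint i j hij := by
    rw [Set.disjoint_left]
    rintro ω rfl h
    exact hij h
  cover := by ext ω; simp

/-- The index of the member of a partition that contains a given point. -/
theorem exists_index (A : Partition Ω) :
    ∃ m : L0Nat P, ∀ᵐ ω ∂P, ω ∈ (A.part (m ω)).1 := by
  refine exists_nat_select (p := fun k ω => ω ∈ (A.part k).1) (fun k => (A.part k).2) ?_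
  refine Eventually.of_forall fun ω => ?_
  have : ω ∈ ⋃ k, (A.part k).1 := by rw [A.cover]; trivial
  simpa using this

/-- Random evaluation of a sequence of random elements. -/
theorem exists_eval {β : Type*} [TopologicalSpace β] [TopologicalSpace.PseudoMetrizableSpace β]
    [SecondCountableTopology β] [MeasurableSpace β] [BorelSpace β]
    (u : ℕ → Ω →ₘ[P] β) (m : L0Nat P) :
    ∃ v : Ω →ₘ[P] β, ∀ᵐ ω ∂P, v ω = u (m ω) ω := by
  have h1 : Measurable fun p : Ω × ℕ => u p.2 p.1 :=
    measurable_from_prod_countable_left fun n => (u n).measurable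
  have h2 : Measurable fun ω => u (m ω) ω :=
    h1.comp (measurable_id.prodMk (measurable_coe_nat m))
  exact ⟨AEEqFun.mk _ h2.aestronglyMeasurable, AEEqFun.coeFn_mk _ _⟩

theorem exists_mk {β : Type*} [TopologicalSpace β] [TopologicalSpace.PseudoMetrizableSpace β]
    [SecondCountableTopology β] [MeasurableSpace β] [BorelSpace β] {g : Ω → β}
    (hg : Measurable g) : ∃ v : Ω →ₘ[P] β, ∀ᵐ ω ∂P, v ω = g ω :=
  ⟨AEEqFun.mk _ hg.aestronglyMeasurable, AEEqFun.coeFn_mk _ _⟩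

theorem exists_pos_inv {r : L0 P} (hr : AELt 0 r) : ∃ s : L0 P, 0 ≤ s ∧ r * s = 1 := by
  obtain ⟨s, hs⟩ := exists_mk (P := P) (measurable_coe r).inv
  refine ⟨s, ?_, ?_⟩
  · rw [le_iff_ae]
    filter_upwards [hr, hs, coeFn_zero (P := P)] with ω h1 h2 h3
    rw [h2, h3, Pi.inv_apply]
    rw [h3] at h1
    exact (inv_pos.mpr h1).le
  · rw [eq_iff_ae]
    filter_upwards [hr, hs, coeFn_zero (P := P), coeFn_one (P := P),
      coeFn_mul r s] with ω h1 h2 h3 h4 h5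
    rw [h3] at h1
    rw [h5, h4, h2, Pi.inv_apply, mul_inv_cancel₀ h1.ne']

end Basic

/-! ### Essential suprema and infima -/

section EssSup

variable {Ω : Type*} [MeasurableSpace Ω] {P : Measure Ω} [IsProbabilityMeasure P]

/-- A nonempty family in `L⁰` has a countable subfamily with the same essential supremum. -/
theorem exists_countable_exhausting {X : Set (L0 P)} (hX : X.Nonempty) :
    ∃ u : ℕ → L0 P, (∀ i, u i ∈ X) ∧ ∀ v ∈ X, ∀ᵐ ω ∂P, ∀ ε > 0, ∃ i, v ω - ε < u i ω := by
  -- The shift by 2 makes the values positive, so that `ENNReal.ofReal` keeps strict monotonicity;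
  -- the bound 4 keeps the integrals finite.
  let g : ℝ → ENNReal := fun t => ENNReal.ofReal (Real.arctan t + 2)
  have hpos : ∀ t, 0 < Real.arctan t + 2 := fun t => by
    have := Real.neg_pi_div_two_lt_arctan t
    have := Real.pi_lt_four
    linarith
  have hgm : Measurable g :=
    ENNReal.measurable_ofReal.comp (Real.continuous_arctan.measurable.add_const 2)
  have hg : ∀ s t, g s < g t ↔ s < t := fun s t => by
    simp only [g]
    rw [ENNReal.ofReal_lt_ofReal_iff (hpos t)]
    simp
  have hg4 : ∀ t, g t ≤ 4 := fun t => by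
    have h1 := Real.arctan_lt_pi_div_two t
    have h2 := Real.pi_lt_four
    calc g t ≤ ENNReal.ofReal 4 := ENNReal.ofReal_le_ofReal (by linarith)
      _ = 4 := by norm_num
  let I : (ℕ → X) → ENNReal := fun u => ∫⁻ ω, ⨆ i, g ((u i : L0 P) ω) ∂P
  have hI4 : ∀ u, I u ≤ 4 := fun u => by
    calc I u ≤ ∫⁻ _, 4 ∂P := lintegral_mono fun ω => iSup_le fun i => hg4 _
      _ = 4 := by simp
  have hmeas : ∀ u : ℕ → X, Measurable fun ω => ⨆ i, g ((u i : L0 P) ω) := fun u =>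
    Measurable.iSup fun i => hgm.comp (measurable_coe _)
  obtain ⟨x0, hx0⟩ := hX
  have : Nonempty (ℕ → X) := ⟨fun _ => ⟨x0, hx0⟩⟩
  -- The supremum of `I` is attained: a maximising sequence of countable families merges into one
  -- family by unpairing.
  obtain ⟨s, -, hs, hsmem⟩ := exists_seq_tendsto_sSup (Set.range_nonempty I) (OrderTop.bddAbove _)
  choose U hU using hsmem
  let w : ℕ → X := fun k => U k.unpair.1 k.unpair.2
  have hw : ∀ u, I u ≤ I w := by
    have h1 : sSup (Set.range I) ≤ I w := by
      refine le_of_tendsto' hs fun n => ?_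
      rw [← hU n]
      refine lintegral_mono fun ω => iSup_le fun i => ?_
      have := le_iSup (fun k => g ((w k : L0 P) ω)) (Nat.pair n i)
      simpa [w] using this
    exact fun u => (le_sSup (Set.mem_range_self u)).trans h1
  refine ⟨fun i => w i, fun i => (w i).2, fun v hv => ?_⟩
  -- Adjoining `v` cannot raise the maximal integral, so it leaves the pointwise supremum unchanged
  -- a.e.
  let w' : ℕ → X := fun k => match k with
    | 0 => ⟨v, hv⟩
    | i + 1 => w i
  have hle : (fun ω => ⨆ i, g ((w i : L0 P) ω)) ≤ᵐ[P] fun ω => ⨆ i, g ((w' i : L0 P) ω) :=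
    Eventually.of_forall fun ω => iSup_le fun i =>
      le_iSup (fun k => g ((w' k : L0 P) ω)) (i + 1)
  have heq := ae_eq_of_ae_le_of_lintegral_le hle
    (ne_top_of_le_ne_top (by norm_num) (hI4 w)) (hmeas w').aemeasurable (hw w')
  filter_upwards [heq] with ω hω ε hε
  have h1 : g (v ω) ≤ ⨆ i, g ((w i : L0 P) ω) := by
    rw [hω]
    exact le_iSup (fun k => g ((w' k : L0 P) ω)) 0
  have h2 : g (v ω - ε) < ⨆ i, g ((w i : L0 P) ω) :=
    ((hg _ _).mpr (by linarith)).trans_le h1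
  obtain ⟨i, hi⟩ := lt_iSup_iff.mp h2
  exact ⟨i, (hg _ _).mp hi⟩

/-- The pointwise supremum of an exhausting sequence is the essential supremum. The sequence is kept
in the conclusion because random indices will select near-maximisers from it. -/
theorem exists_isLUB_L0 {X : Set (L0 P)} (hX : X.Nonempty) (hb : BddAbove X) :
    ∃ s, IsLUB X s ∧ ∃ u : ℕ → L0 P, (∀ i, u i ∈ X) ∧
      ∀ᵐ ω ∂P, ∀ ε > 0, ∃ i, s ω - ε < u i ω := by
  obtain ⟨u, huX, hu⟩ := exists_countable_exhausting hX
  obtain ⟨b, hb⟩ := hb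
  obtain ⟨s, hs⟩ := exists_mk (P := P) (Measurable.iSup fun i => measurable_coe (u i))
  have hub : ∀ᵐ ω ∂P, ∀ i, u i ω ≤ b ω := ae_all_iff.mpr fun i => le_iff_ae.mp (hb (huX i))
  refine ⟨s, ⟨fun v hv => ?_, fun c hc => ?_⟩, u, huX, ?_⟩
  · rw [le_iff_ae]
    filter_upwards [hs, hub, hu v hv] with ω h1 h2 h3
    rw [h1]
    refine le_of_forall_pos_lt_add fun ε hε => ?_
    obtain ⟨i, hi⟩ := h3 ε hε
    have := le_ciSup (f := fun i => u i ω) ⟨b ω, Set.forall_mem_range.mpr h2⟩ i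
    linarith
  · have huc : ∀ᵐ ω ∂P, ∀ i, u i ω ≤ c ω := ae_all_iff.mpr fun i => le_iff_ae.mp (hc (huX i))
    rw [le_iff_ae]
    filter_upwards [hs, huc] with ω h1 h2
    rw [h1]
    exact ciSup_le h2
  · filter_upwards [hs] with ω h1 ε hε
    rw [h1]
    exact exists_lt_of_lt_ciSup (by linarith)

theorem exists_isGLB_L0 {X : Set (L0 P)} (hX : X.Nonempty) (hb : BddBelow X) :
    ∃ s, IsGLB X s ∧ ∃ u : ℕ → L0 P, (∀ i, u i ∈ X) ∧
      ∀ᵐ ω ∂P, ∀ ε > 0, ∃ i, u i ω < s ω + ε := by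
  obtain ⟨s, hs, u, huX, hu⟩ := exists_isLUB_L0 (X := -X) hX.neg hb.neg
  refine ⟨-s, ?_, fun i => -u i, huX, ?_⟩
  · rw [← isLUB_neg]; simpa using hs
  · have h1 : ∀ᵐ ω ∂P, ∀ i, (-u i) ω = -u i ω := ae_all_iff.mpr fun i => coeFn_neg _
    filter_upwards [hu, h1, coeFn_neg s] with ω h2 h3 h4 ε hε
    obtain ⟨i, hi⟩ := h2 ε hε
    exact ⟨i, by rw [h3, h4]; linarith⟩

end EssSup

/-! ### Concatenations and local functions -/

section Concatenation

variable {Ω : Type*} [MeasurableSpace Ω] {P : Measure Ω}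
  {E : Type*} [AddCommGroup E] [Module (L0 P) E]

/-- The concatenation of `x` along the level sets of `m`. -/
noncomputable def cat (hE : IsStableModule P E) (x : ℕ → E) (m : L0Nat P) : E :=
  (hE (levelPartition m) x).exists.choose

theorem isConcat_cat (hE : IsStableModule P E) (x : ℕ → E) (m : L0Nat P) :
    IsConcat (ModEq P E) (levelPartition m) x (cat hE x m) :=
  (hE (levelPartition m) x).exists.choose_spec

theorem cat_mem (hE : IsStableModule P E) {S : Set E} (hS : IsStableSet (ModEq P E) S)
    {x : ℕ → E} (hx : ∀ i, x i ∈ S) (m : L0Nat P) : cat hE x m ∈ S :=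
  hS.2 _ x _ hx (isConcat_cat hE x m)

/-- Functions `g : E → L⁰` whose values on an event depend only on the argument there. -/
def IsLocal (g : E → L0 P) : Prop :=
  ∀ (A : Event Ω) (x y : E), ModEq P E A x y → ∀ᵐ ω ∂P, ω ∈ A.1 → g x ω = g y ω

/-- The part that contains ω has number `m ω`, and only countably many null sets are discarded.
Through this formula identities on concatenations become pointwise. -/
theorem IsLocal.isConcat {g : E → L0 P} (hg : IsLocal g) {m : L0Nat P} {x : ℕ → E} {z : E}
    (hz : IsConcat (ModEq P E) (levelPartition m) x z) : ∀ᵐ ω ∂P, g z ω = g (x (m ω)) ω := by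
  have : ∀ᵐ ω ∂P, ∀ k, ω ∈ ((levelPartition m).part k).1 → g z ω = g (x k) ω :=
    ae_all_iff.mpr fun k => hg _ _ _ (hz k)
  filter_upwards [this] with ω h
  exact h (m ω) rfl

theorem IsLocal.cat {g : E → L0 P} (hg : IsLocal g) (hE : IsStableModule P E) (x : ℕ → E)
    (m : L0Nat P) : ∀ᵐ ω ∂P, g (cat hE x m) ω = g (x (m ω)) ω :=
  hg.isConcat (isConcat_cat hE x m)

theorem ae_eq_of_ind_mul {A : Event Ω} {a b : L0 P} (h : ind P A * a = ind P A * b) :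
    ∀ᵐ ω ∂P, ω ∈ A.1 → a ω = b ω := by
  filter_upwards [eq_iff_ae.mp h, coeFn_mul (ind P A) a, coeFn_mul (ind P A) b,
    coeFn_ind (P := P) A] with ω h1 h2 h3 h4 hA
  rw [h2, h3, h4, Set.indicator_of_mem hA] at h1
  simpa using h1

theorem ind_mul_eq_of_ae {A : Event Ω} {a b : L0 P} (h : ∀ᵐ ω ∂P, ω ∈ A.1 → a ω = b ω) :
    ind P A * a = ind P A * b := by
  rw [eq_iff_ae]
  filter_upwards [h, coeFn_mul (ind P A) a, coeFn_mul (ind P A) b,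
    coeFn_ind (P := P) A] with ω h1 h2 h3 h4
  rw [h2, h3, h4]
  by_cases hA : ω ∈ A.1
  · rw [h1 hA]
  · simp [Set.indicator_of_notMem hA]

theorem isLocal_linearMap (f : E →ₗ[L0 P] L0 P) : IsLocal f := fun A x y h => by
  refine ae_eq_of_ind_mul ?_
  have := congrArg f h
  simpa using this

theorem abs_ind (A : Event Ω) : |ind P A| = ind P A := by
  refine abs_of_nonneg ?_
  rw [le_iff_ae]
  filter_upwards [coeFn_ind (P := P) A, coeFn_zero (P := P)] with ω h1 h2
  rw [h1, h2]
  exact Set.indicator_nonneg (fun _ _ => zero_le_one) ω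

theorem IsL0Norm.isLocal_sub {N : E → L0 P} (hN : IsL0Norm N) (d : E) :
    IsLocal fun x => N (x - d) := fun A x y h => by
  refine ae_eq_of_ind_mul ?_
  have h1 : ind P A • (x - d) = ind P A • (y - d) := by
    rw [smul_sub, smul_sub, show ind P A • x = ind P A • y from h]
  have := congrArg N h1
  simpa only [hN.smul, abs_ind] using this

theorem IsL0Norm.neg {N : E → L0 P} (hN : IsL0Norm N) (x : E) : N (-x) = N x := by
  have := hN.smul (-1) x
  rwa [neg_smul, one_smul, abs_neg, abs_of_nonneg zero_le_one, one_mul] at this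

theorem IsL0Norm.sub_comm {N : E → L0 P} (hN : IsL0Norm N) (x y : E) : N (x - y) = N (y - x) := by
  rw [← hN.neg, neg_sub]

theorem IsL0Norm.zero {N : E → L0 P} (hN : IsL0Norm N) : N 0 = 0 := by
  have := hN.smul 0 0
  simpa using this

theorem modEq_iff_ae {N : E → L0 P} (hN : IsL0Norm N) {A : Event Ω} {x y : E} :
    ModEq P E A x y ↔ ∀ᵐ ω ∂P, ω ∈ A.1 → N (x - y) ω = 0 := by
  constructor
  · intro h
    filter_upwards [hN.isLocal_sub y A x y h, coeFn_zero (P := P)] with ω h1 h2 hA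
    rw [h1 hA, sub_self, hN.zero, h2]
  · intro h
    have h1 : N (ind P A • (x - y)) = 0 := by
      rw [hN.smul, abs_ind, ← mul_zero (ind P A)]
      refine ind_mul_eq_of_ae ?_
      filter_upwards [h, coeFn_zero (P := P)] with ω h1 h2 hA
      rw [h1 hA, h2]
    have := hN.eq_zero _ h1
    rwa [smul_sub, sub_eq_zero] at this

end Concatenation

/-! ### Hahn–Banach over a Dedekind complete ordered ring -/

section HahnBanach

variable {R M : Type*} [CommRing R] [PartialOrder R] [IsOrderedRing R] [AddCommGroup M] [Module R M]

/-- Nonnegative units whose inverse is nonnegative. -/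
def IsPosUnit (r : R) : Prop := 0 ≤ r ∧ ∃ s, 0 ≤ s ∧ r * s = 1

theorem IsPosUnit.one : IsPosUnit (1 : R) := ⟨zero_le_one, 1, zero_le_one, one_mul 1⟩

theorem IsPosUnit.mul {r s : R} (hr : IsPosUnit r) (hs : IsPosUnit s) : IsPosUnit (r * s) := by
  obtain ⟨hr0, r', hr', hrr⟩ := hr
  obtain ⟨hs0, s', hs', hss⟩ := hs
  exact ⟨mul_nonneg hr0 hs0, r' * s', mul_nonneg hr' hs', by
    rw [mul_mul_mul_comm, hrr, hss, one_mul]⟩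

/-- Maps to an ordered ring that are subadditive and homogeneous for positive units. -/
structure IsSublinear (q : M → R) : Prop where
  add_le : ∀ x y, q (x + y) ≤ q x + q y
  smul_le : ∀ (r : R) (x : M), IsPosUnit r → q (r • x) ≤ r * q x

/-- The missing inequality is homogeneity applied to the inverse of `r` and the vector `r • x`. -/
theorem IsSublinear.smul {q : M → R} (hq : IsSublinear q) {r : R} (hr : IsPosUnit r) (x : M) :
    q (r • x) = r * q x := by
  refine le_antisymm (hq.smul_le r x hr) ?_
  obtain ⟨hr0, s, hs0, hrs⟩ := hr
  have h1 := hq.smul_le s (r • x) ⟨hs0, r, hr0, by rwa [mul_comm]⟩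
  rw [smul_smul, mul_comm s r, hrs, one_smul] at h1
  calc r * q x ≤ r * (s * q (r • x)) := mul_le_mul_of_nonneg_left h1 hr0
    _ = q (r • x) := by rw [← mul_assoc, hrs, one_mul]

theorem IsSublinear.zero_nonneg {q : M → R} (hq : IsSublinear q) : 0 ≤ q 0 := by
  have := hq.add_le 0 0
  rw [add_zero] at this
  simpa using this

theorem IsSublinear.neg_le {q : M → R} (hq : IsSublinear q) (x : M) :
    -q (-x) ≤ q x := by
  have := hq.add_le x (-x)
  rw [add_neg_cancel] at this
  rw [neg_le_iff_add_nonneg]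
  exact hq.zero_nonneg.trans this

/-- Multiplication by positive units preserves lower bounds in the limit. -/
theorem IsPosUnit.le_mul_of_isGLB {r : R} (hr : IsPosUnit r) {X : Set R} {a b : R}
    (ha : IsGLB X a) (h : ∀ v ∈ X, b ≤ r * v) : b ≤ r * a := by
  obtain ⟨hr0, s, hs0, hrs⟩ := hr
  have h1 : s * b ≤ a := ha.2 fun v hv => by
    calc s * b ≤ s * (r * v) := mul_le_mul_of_nonneg_left (h v hv) hs0
      _ = v := by rw [← mul_assoc, mul_comm s r, hrs, one_mul]
  calc b = r * (s * b) := by rw [← mul_assoc, hrs, one_mul]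
    _ ≤ r * a := mul_le_mul_of_nonneg_left h1 hr0

variable (hR : ∀ X : Set R, X.Nonempty → BddBelow X → ∃ a, IsGLB X a)

include hR in
/-- The infimum of a chain of sublinear maps is sublinear. -/
theorem exists_isSublinear_lowerBound {c : Set (M → R)} (hc : IsChain (· ≤ ·) c)
    (hcne : c.Nonempty) (hcs : ∀ q ∈ c, IsSublinear q) {p : M → R} (hp : ∀ q ∈ c, q ≤ p) :
    ∃ q : M → R, IsSublinear q ∧ ∀ q' ∈ c, q ≤ q' := by
  have h1 : ∀ x, ∃ a, IsGLB ((fun q : M → R => q x) '' c) a := fun x => by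
    refine hR _ (hcne.image _) ⟨-p (-x), ?_⟩
    rintro _ ⟨q, hq, rfl⟩
    exact (neg_le_neg (hp q hq (-x))).trans ((hcs q hq).neg_le x)
  choose q hq using h1
  refine ⟨q, ⟨fun x y => ?_, fun r x hr => ?_⟩, fun q' hq' x => (hq x).1 ⟨q', hq', rfl⟩⟩
  · rw [← sub_le_iff_le_add]
    refine (hq x).2 ?_
    rintro _ ⟨q1, hq1, rfl⟩
    rw [sub_le_iff_le_add, ← sub_le_iff_le_add']
    refine (hq y).2 ?_
    rintro _ ⟨q2, hq2, rfl⟩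
    rw [sub_le_iff_le_add']
    -- The two infima are tested with different members of the chain; the smaller member serves for
    -- both.
    rcases hc.total hq1 hq2 with h | h
    · exact ((hq (x + y)).1 ⟨q1, hq1, rfl⟩).trans
        (((hcs q1 hq1).add_le x y).trans (add_le_add le_rfl (h y)))
    · exact ((hq (x + y)).1 ⟨q2, hq2, rfl⟩).trans
        (((hcs q2 hq2).add_le x y).trans (add_le_add (h x) le_rfl))
  · refine hr.le_mul_of_isGLB (hq x) ?_
    rintro _ ⟨q1, hq1, rfl⟩
    exact ((hq (r • x)).1 ⟨q1, hq1, rfl⟩).trans ((hcs q1 hq1).smul_le r x hr)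

include hR in
/-- Lowering a sublinear map so as to make it additive in the direction of `z`. -/
theorem exists_isSublinear_le_sub (hadd : ∀ r s : R, IsPosUnit r → IsPosUnit s → IsPosUnit (r + s))
    {q : M → R} (hq : IsSublinear q) (z : M) :
    ∃ q' : M → R, IsSublinear q' ∧ q' ≤ q ∧ ∀ y, q' y ≤ q (y + z) - q z := by
  -- The lowered map is the infimum of `q (y + t • z) - t * q z` over positive units `t`; the choice
  -- `t = 1` gives both upper bounds.
  have h1 : ∀ y, ∃ a, IsGLB ((fun t : R => q (y + t • z) - t * q z) '' {t | IsPosUnit t}) a :=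
    fun y => by
      refine hR _ (Set.Nonempty.image _ ⟨1, IsPosUnit.one⟩) ⟨-q (-y), ?_⟩
      rintro _ ⟨t, ht, rfl⟩
      have h2 := hq.add_le (y + t • z) (-y)
      rw [add_neg_cancel_comm, hq.smul ht] at h2
      simp only
      rw [le_sub_iff_add_le, neg_add_le_iff_le_add, add_comm]
      exact h2
  choose q' hq' using h1
  refine ⟨q', ⟨fun x y => ?_, fun r x hr => ?_⟩, fun y => ?_, fun y => ?_⟩
  · rw [← sub_le_iff_le_add]
    refine (hq' x).2 ?_
    rintro _ ⟨s, hs, rfl⟩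
    rw [sub_le_iff_le_add, ← sub_le_iff_le_add']
    refine (hq' y).2 ?_
    rintro _ ⟨t, ht, rfl⟩
    rw [sub_le_iff_le_add']
    have h2 := (hq' (x + y)).1 ⟨s + t, hadd s t hs ht, rfl⟩
    refine h2.trans ?_
    have h3 := hq.add_le (x + s • z) (y + t • z)
    have h4 : x + y + (s + t) • z = x + s • z + (y + t • z) := by rw [add_smul]; abel
    simp only
    rw [h4]
    calc q (x + s • z + (y + t • z)) - (s + t) * q z
        ≤ q (x + s • z) + q (y + t • z) - (s + t) * q z := sub_le_sub_right h3 _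
      _ = _ := by ring
  · refine hr.le_mul_of_isGLB (hq' x) ?_
    rintro _ ⟨t, ht, rfl⟩
    refine ((hq' (r • x)).1 ⟨r * t, hr.mul ht, rfl⟩).trans (le_of_eq ?_)
    simp only
    rw [mul_smul, ← smul_add, hq.smul hr]
    ring
  · refine ((hq' y).1 ⟨1, IsPosUnit.one, rfl⟩).trans ?_
    simp only
    rw [one_smul, one_mul, sub_le_iff_le_add]
    exact hq.add_le y z
  · refine ((hq' y).1 ⟨1, IsPosUnit.one, rfl⟩).trans (le_of_eq ?_)
    simp

include hR in
/-- The **Hahn–Banach theorem** for modules over a Dedekind complete ordered ring. -/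
theorem exists_linearMap_le_sublinear
    (hadd : ∀ r s : R, IsPosUnit r → IsPosUnit s → IsPosUnit (r + s))
    (hdiff : ∀ r : R, ∃ u v, IsPosUnit u ∧ IsPosUnit v ∧ r = u - v)
    {p : M → R} (hp : IsSublinear p) (hp0 : p 0 = 0) (z : M) :
    ∃ f : M →ₗ[R] R, (∀ x, f x ≤ p x) ∧ f z = p z := by
  -- Lowering `p` at `z` beforehand forces `f (-z) ≤ -p z`, which is what makes `f` attain `p` at
  -- `z`.
  obtain ⟨p', hp', hp'p, hp'z⟩ := exists_isSublinear_le_sub hR hadd hp z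
  -- Zorn in the reversed order. A minimal `q` lies below its own lowering in every direction `x`,
  -- so `q y ≤ q (y + x) - q x`: the missing half of additivity.
  obtain ⟨q, hqp, ⟨hq, -⟩, hqmin⟩ := zorn_le_nonempty₀ (α := (M → R)ᵒᵈ)
    {q | IsSublinear (OrderDual.ofDual q) ∧ OrderDual.toDual p' ≤ q} (fun c hc hchain y hy => by
      obtain ⟨q, hq, hqc⟩ := exists_isSublinear_lowerBound hR (c := OrderDual.toDual ⁻¹' c)
        (p := p') hchain.symm ⟨OrderDual.ofDual y, hy⟩ (fun q hq => (hc hq).1)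
        (fun q hq => OrderDual.toDual_le_toDual.mp (hc hq).2)
      exact ⟨OrderDual.toDual q, ⟨hq, OrderDual.toDual_le_toDual.mpr
          ((hqc (OrderDual.ofDual y) hy).trans (OrderDual.toDual_le_toDual.mp (hc hy).2))⟩,
        fun z hz x => hqc (OrderDual.ofDual z) hz x⟩) (OrderDual.toDual p') ⟨hp', le_rfl⟩
  obtain ⟨q, rfl⟩ := OrderDual.toDual.surjective q
  simp only [OrderDual.ofDual_toDual, OrderDual.toDual_le_toDual] at hqp hq
  have hadd' : ∀ x y, q (x + y) = q x + q y := fun y x => by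
    refine le_antisymm (hq.add_le y x) ?_
    obtain ⟨q', hq', hq'q, hq'x⟩ := exists_isSublinear_le_sub hR hadd hq x
    have : q ≤ q' := hqmin (y := OrderDual.toDual q')
      ⟨hq', OrderDual.toDual_le_toDual.mpr (hq'q.trans hqp)⟩
      (OrderDual.toDual_le_toDual.mpr hq'q)
    have h2 := (this y).trans (hq'x y)
    rwa [le_sub_iff_add_le] at h2
  let g : M →+ R := AddMonoidHom.mk' q hadd'
  have hg : ∀ x, g x = q x := fun x => rfl
  let f : M →ₗ[R] R :=
    { toFun := q
      map_add' := hadd'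
      map_smul' := fun r x => by
        obtain ⟨u, v, hu, hv, rfl⟩ := hdiff r
        simp only [RingHom.id_apply, smul_eq_mul]
        rw [sub_smul, ← hg, map_sub, hg, hg, hq.smul hu, hq.smul hv, sub_mul] }
  refine ⟨f, fun x => (hqp x).trans (hp'p x), ?_⟩
  have h1 : f (-z) ≤ p 0 - p z := (hqp (-z)).trans (by simpa using hp'z (-z))
  rw [map_neg, hp0, zero_sub, neg_le_neg_iff] at h1
  exact le_antisymm ((hqp z).trans (hp'p z)) h1

end HahnBanach

/-! ### Norming and separating functionals, countable closures -/

section Duality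

variable {Ω : Type*} [MeasurableSpace Ω] {P : Measure Ω}
  {E : Type*} [AddCommGroup E] [Module (L0 P) E]

theorem isPosUnit_iff {r : L0 P} : IsPosUnit r ↔ AELt 0 r := by
  constructor
  · rintro ⟨h0, s, -, hs⟩
    filter_upwards [le_iff_ae.mp h0, coeFn_zero (P := P), coeFn_mul r s, coeFn_one (P := P)] with
      ω h1 h2 h3 h4
    rw [hs, h4] at h3
    rw [h2] at h1 ⊢
    rcases h1.eq_or_lt with h | h
    · rw [← h, zero_mul] at h3
      exact absurd h3 one_ne_zero
    · exact h
  · intro h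
    refine ⟨?_, exists_pos_inv h⟩
    rw [le_iff_ae]
    filter_upwards [h] with ω h1 using h1.le

theorem exists_sub_isPosUnit (r : L0 P) : ∃ u v, IsPosUnit u ∧ IsPosUnit v ∧ r = u - v := by
  refine ⟨|r| + 1, |r| + 1 - r, ?_, ?_, by ring⟩ <;> rw [isPosUnit_iff]
  · filter_upwards [coeFn_add |r| 1, coeFn_abs r, coeFn_one (P := P), coeFn_zero (P := P)] with
      ω h1 h2 h3 h4
    rw [h1, h2, h3, h4]
    positivity
  · filter_upwards [coeFn_add |r| 1, coeFn_abs r, coeFn_one (P := P), coeFn_zero (P := P),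
      coeFn_sub (|r| + 1) r] with ω h1 h2 h3 h4 h5
    rw [h5, h1, h2, h3, h4]
    linarith [le_abs_self (r ω)]

theorem isPosUnit_add (r s : L0 P) (hr : IsPosUnit r) (hs : IsPosUnit s) : IsPosUnit (r + s) := by
  rw [isPosUnit_iff] at *
  filter_upwards [hr, hs, coeFn_zero (P := P), coeFn_add r s] with ω h1 h2 h3 h4
  rw [h3] at h1 h2
  rw [h3, h4]
  exact add_pos h1 h2

/-- The **Hahn–Banach theorem** for `L⁰`-seminorms. -/
theorem exists_linearMap_le_seminorm [IsProbabilityMeasure P] {p : E → L0 P}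
    (hadd : ∀ x y, p (x + y) ≤ p x + p y) (hsmul : ∀ (r : L0 P) x, p (r • x) ≤ |r| * p x) (z : E) :
    ∃ f : E →ₗ[L0 P] L0 P, (∀ x, |f x| ≤ p x) ∧ f z = p z := by
  have hp : IsSublinear p := ⟨hadd, fun r x hr => by
    have := hsmul r x
    rwa [abs_of_nonneg hr.1] at this⟩
  have hp0 : p 0 = 0 := by
    refine le_antisymm ?_ hp.zero_nonneg
    have := hsmul 0 0
    rwa [zero_smul, abs_zero, zero_mul] at this
  obtain ⟨f, hf, hfz⟩ := exists_linearMap_le_sublinear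
    (fun X hX hb => (exists_isGLB_L0 hX hb).imp fun a ha => ha.1)
    isPosUnit_add exists_sub_isPosUnit hp hp0 z
  refine ⟨f, fun x => ?_, hfz⟩
  rw [abs_le']
  refine ⟨hf x, ?_⟩
  have h1 := hf (-x)
  have h2 := hsmul (-1) x
  rw [neg_smul, one_smul, abs_neg, abs_of_nonneg zero_le_one, one_mul] at h2
  rw [map_neg] at h1
  exact h1.trans h2

/-- The unit ball of the dual. -/
def dualBall (N : E → L0 P) : Set (E →ₗ[L0 P] L0 P) := {f | ∀ x, |f x| ≤ N x}

theorem dualBall_ae {N : E → L0 P} {f : E →ₗ[L0 P] L0 P} (hf : f ∈ dualBall N) (x : E) :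
    ∀ᵐ ω ∂P, |f x ω| ≤ N x ω := by
  filter_upwards [le_iff_ae.mp (hf x), coeFn_abs (f x)] with ω h1 h2
  rwa [← h2]

theorem dualBall_sub_ae {N : E → L0 P} {f : E →ₗ[L0 P] L0 P} (hf : f ∈ dualBall N) (x y : E) :
    ∀ᵐ ω ∂P, |f x ω - f y ω| ≤ N (x - y) ω := by
  filter_upwards [dualBall_ae hf (x - y), coeFn_sub (f x) (f y)] with ω h1 h2
  rwa [map_sub, h2] at h1

/-- Norming functionals exist. -/
theorem exists_norming [IsProbabilityMeasure P] {N : E → L0 P} (hN : IsL0Norm N) (z : E) :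
    ∃ f ∈ dualBall N, f z = N z :=
  exists_linearMap_le_seminorm hN.add_le (fun r x => (hN.smul r x).le) z

variable (P) in
/-- Countable subgroups that are closed under multiplication with rational constants. -/
structure IsRatClosed (D : Set E) : Prop where
  countable : D.Countable
  zero_mem : 0 ∈ D
  add_mem : ∀ x ∈ D, ∀ y ∈ D, x + y ∈ D
  smul_mem : ∀ q : ℚ, ∀ x ∈ D, (AEEqFun.const Ω (q : ℝ) : L0 P) • x ∈ D

/-- The distance from a set that is closed under rational combinations is an `L⁰`-seminorm. -/
theorem exists_distance {N : E → L0 P} (hN : IsL0Norm N) {D : Set E} (hD : IsRatClosed P D) :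
    ∃ p : E → L0 P, (∀ x y, p (x + y) ≤ p x + p y) ∧ (∀ (r : L0 P) x, p (r • x) ≤ |r| * p x) ∧
      (∀ x, p x ≤ N x) ∧ (∀ d ∈ D, p d = 0) ∧
      ∀ x, ∀ᵐ ω ∂P, ∀ ε > 0, ∃ d ∈ D, N (x - d) ω < p x ω + ε := by
  have := hD.countable.to_subtype
  have : Nonempty D := ⟨⟨0, hD.zero_mem⟩⟩
  -- The distance is taken as a pointwise infimum; countability of `D` makes it measurable and
  -- permits a common null set.
  choose p hp using fun x => exists_mk (P := P)
    (Measurable.iInf fun d : D => measurable_coe (N (x - d)))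
  have hnn : ∀ x, ∀ᵐ ω ∂P, 0 ≤ N x ω := fun x => by
    filter_upwards [le_iff_ae.mp (hN.nonneg x), coeFn_zero (P := P)] with ω h1 h2
    rwa [← h2]
  have hbdd : ∀ x, ∀ᵐ ω ∂P, BddBelow (Set.range fun d : D => N (x - d) ω) := fun x => by
    filter_upwards [ae_all_iff.mpr fun d : D => hnn (x - d)] with ω h1
    exact ⟨0, Set.forall_mem_range.mpr h1⟩
  have hle : ∀ x, ∀ᵐ ω ∂P, ∀ d : D, p x ω ≤ N (x - d) ω := fun x => by
    filter_upwards [hp x, hbdd x] with ω h1 h2 d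
    rw [h1]
    exact ciInf_le h2 d
  refine ⟨p, fun x y => ?_, fun r x => ?_, fun x => ?_, fun d hd => ?_, fun x => ?_⟩
  · have h : ∀ᵐ ω ∂P, ∀ d d' : D, p (x + y) ω ≤ N (x - d) ω + N (y - d') ω := by
      refine ae_all_iff.mpr fun d => ae_all_iff.mpr fun d' => ?_
      filter_upwards [hle (x + y), le_iff_ae.mp (hN.add_le (x - d) (y - d')),
        coeFn_add (N (x - d)) (N (y - d'))] with ω h1 h2 h3
      refine (h1 ⟨d + d', hD.add_mem d d.2 d' d'.2⟩).trans ?_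
      rw [← h3, add_sub_add_comm]
      exact h2
    rw [le_iff_ae]
    filter_upwards [h, hp x, hp y, coeFn_add (p x) (p y)] with ω h1 h2 h3 h4
    rw [h4, h2, h3]
    exact le_ciInf_add_ciInf h1
  -- `D` admits only rational multiples, so the random factor `r` is replaced by a constant `q`. The
  -- error `|r ω - q| * N d ω` is made small separately at each ω.
  · have h : ∀ᵐ ω ∂P, ∀ (d : D) (q : ℚ),
        p (r • x) ω ≤ |r ω| * N (x - d) ω + |r ω - q| * N d ω := by
      refine ae_all_iff.mpr fun d => ae_all_iff.mpr fun q => ?_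
      let c : L0 P := AEEqFun.const Ω (q : ℝ)
      have hc : r • x - c • (d : E) = r • (x - d) + (r - c) • (d : E) := by
        rw [smul_sub, sub_smul]; abel
      filter_upwards [hle (r • x), le_iff_ae.mp (hN.add_le (r • (x - d)) ((r - c) • (d : E))),
        coeFn_add (N (r • (x - d))) (N ((r - c) • (d : E))), coeFn_cst (P := P) (q : ℝ),
        coeFn_sub r c, coeFn_mul |r| (N (x - d)), coeFn_mul |r - c| (N d), coeFn_abs r,
        coeFn_abs (r - c)] with ω h1 h2 h3 h4 h5 h6 h7 h8 h9
      refine (h1 ⟨c • (d : E), hD.smul_mem q d d.2⟩).trans ?_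
      simp only
      rw [hc]
      rw [h3, hN.smul, hN.smul, h6, h7, h8, h9, h5, h4] at h2
      exact h2
    rw [le_iff_ae]
    filter_upwards [h, hp x, coeFn_mul |r| (p x), coeFn_abs r,
      ae_all_iff.mpr fun d : D => hnn d] with ω h1 h2 h3 h4 h5
    rw [h3, h4, h2, Real.mul_iInf_of_nonneg (abs_nonneg _)]
    refine le_ciInf fun d => le_of_forall_pos_le_add fun δ hδ => ?_
    have h6 : 0 < δ / (N d ω + 1) := div_pos hδ (by linarith [h5 d])
    obtain ⟨q, hq1, hq2⟩ := exists_rat_btwn (show r ω < r ω + δ / (N d ω + 1) by linarith)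
    refine (h1 d q).trans (add_le_add le_rfl ?_)
    have h7 : |r ω - q| ≤ δ / (N d ω + 1) := by rw [abs_le]; constructor <;> linarith
    calc |r ω - q| * N d ω ≤ δ / (N d ω + 1) * (N d ω + 1) :=
          mul_le_mul h7 (by linarith) (h5 d) h6.le
      _ = δ := div_mul_cancel₀ _ (by linarith [h5 d])
  · rw [le_iff_ae]
    filter_upwards [hle x] with ω h1
    simpa using h1 ⟨0, hD.zero_mem⟩
  · rw [eq_iff_ae]
    filter_upwards [hle d, hp d, ae_all_iff.mpr fun d' : D => hnn (d - d'),
      coeFn_zero (P := P)] with ω h1 h2 h3 h4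
    rw [h4]
    refine le_antisymm ?_ ?_
    · have := h1 ⟨d, hd⟩
      rwa [sub_self, hN.zero, h4] at this
    · rw [h2]
      exact Real.iInf_nonneg h3
  · filter_upwards [hp x] with ω h1 ε hε
    rw [h1]
    obtain ⟨d, hd⟩ := exists_lt_of_ciInf_lt (lt_add_of_pos_right (⨅ d : D, N (x - d) ω) hε)
    exact ⟨d, d.2, hd⟩

/-- Functionals that vanish on `D` detect whether a point is in the closure of `D`. -/
theorem exists_separating [IsProbabilityMeasure P] {N : E → L0 P} (hN : IsL0Norm N) {D : Set E}
    (hD : IsRatClosed P D) (z : E) :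
    ∃ f ∈ dualBall N, (∀ d ∈ D, f d = 0) ∧
      (f z = 0 → ∀ᵐ ω ∂P, ∀ ε > 0, ∃ d ∈ D, N (z - d) ω < ε) := by
  obtain ⟨p, hadd, hsmul, hpN, hpD, hp⟩ := exists_distance hN hD
  obtain ⟨f, hf, hfz⟩ := exists_linearMap_le_seminorm hadd hsmul z
  refine ⟨f, fun x => (hf x).trans (hpN x), fun d hd => ?_, fun h0 => ?_⟩
  · have := hf d
    rw [hpD d hd] at this
    rw [eq_iff_ae]
    filter_upwards [le_iff_ae.mp this, coeFn_abs (f d), coeFn_zero (P := P)] with ω h1 h2 h3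
    rw [h2, h3] at h1
    rw [h3]
    exact abs_nonpos_iff.mp h1
  · rw [hfz] at h0
    filter_upwards [hp z, eq_iff_ae.mp h0, coeFn_zero (P := P)] with ω h1 h2 h3
    rw [h2, h3] at h1
    simpa using h1

theorem countable_finset_subset {α : Type*} {s : Set α} (hs : s.Countable) :
    {F : Finset α | ↑F ⊆ s}.Countable := by
  refine Set.Countable.mono (fun F hF => ?_)
    ((Set.countable_ofPred_finite_subset hs).preimage_of_injOn
      (f := fun F : Finset α => (F : Set α)) Finset.coe_injective.injOn)
  exact ⟨F.finite_toSet, hF⟩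

/-- Countable sets can be closed off under countably many finitary operations. -/
theorem exists_countable_closed {α : Type*} (T : Finset α → Set α) (hT : ∀ F, (T F).Countable) :
    ∃ D : Set α, D.Countable ∧ ∀ F : Finset α, ↑F ⊆ D → T F ⊆ D := by
  let D : ℕ → Set α := fun n => Nat.rec ∅ (fun _ C => C ∪ ⋃ F ∈ {F : Finset α | ↑F ⊆ C}, T F) n
  have hD : ∀ n, D (n + 1) = D n ∪ ⋃ F ∈ {F : Finset α | ↑F ⊆ D n}, T F := fun n => rfl
  have hmono : Monotone D := monotone_nat_of_le_succ fun n => by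
    rw [hD]; exact Set.subset_union_left
  have hcount : ∀ n, (D n).Countable := fun n => by
    induction n with
    | zero => exact Set.countable_empty
    | succ n ih =>
      rw [hD]
      exact ih.union ((countable_finset_subset ih).biUnion fun F _ => hT F)
  refine ⟨⋃ n, D n, Set.countable_iUnion hcount, fun F hF => ?_⟩
  obtain ⟨n, hn⟩ := (directed_of_isDirected_le hmono).exists_mem_subset_of_finset_subset_biUnion hF
  refine Set.Subset.trans ?_ (Set.subset_iUnion D (n + 1))
  rw [hD]
  exact fun x hx => Or.inr (Set.mem_biUnion (show F ∈ {F : Finset α | ↑F ⊆ D n} from hn) hx)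

/-- A countable set that is closed under rational combinations and further finitary operations. -/
theorem exists_isRatClosed (T : Finset E → Set E) (hT : ∀ F, (T F).Countable) :
    ∃ D : Set E, IsRatClosed P D ∧ ∀ F : Finset E, ↑F ⊆ D → T F ⊆ D := by
  classical
  obtain ⟨D, hD, hDT⟩ := exists_countable_closed (fun F : Finset E => T F ∪ ({0} ∪
      ((⋃ x ∈ F, ⋃ y ∈ F, {x + y}) ∪
        ⋃ x ∈ F, ⋃ q : ℚ, {(AEEqFun.const Ω (q : ℝ) : L0 P) • x}))) fun F => by
    refine (hT F).union ((Set.countable_singleton _).union (Set.Countable.union ?_ ?_))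
    · exact F.countable_toSet.biUnion fun x _ => F.countable_toSet.biUnion fun y _ =>
        Set.countable_singleton _
    · exact F.countable_toSet.biUnion fun x _ => Set.countable_iUnion fun q =>
        Set.countable_singleton _
  refine ⟨D, ⟨hD, ?_, fun x hx y hy => ?_, fun q x hx => ?_⟩, fun F hF => ?_⟩
  · exact hDT ∅ (by simp) (by simp)
  · refine hDT {x, y} (by simp [Set.insert_subset_iff, hx, hy]) ?_
    refine Or.inr (Or.inr (Or.inl ?_))
    simp only [Set.mem_iUnion]
    exact ⟨x, by simp, y, by simp, rfl⟩
  · refine hDT {x} (by simp [hx]) (Or.inr (Or.inr (Or.inr ?_)))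
    simp only [Set.mem_iUnion]
    exact ⟨x, by simp, q, rfl⟩
  · exact Set.Subset.trans Set.subset_union_left (hDT F hF)

end Duality

/-! ### Balls and neighbourhoods in the two topologies -/

section Topology

variable {Ω : Type*} [MeasurableSpace Ω] {P : Measure Ω}
  {E : Type*} [AddCommGroup E]

theorem AELt.of_le_of_lt {a b c : L0 P} (h : a ≤ b) (h' : AELt b c) : AELt a c := by
  filter_upwards [le_iff_ae.mp h, h'] with ω h1 h2 using h1.trans_lt h2

theorem aeLt_of_mem_seminormBall {x y : E} {𝒩 : Set (E → L0 P)} {r : L0 P}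
    (h : y ∈ seminormBall x 𝒩 r) {p : E → L0 P} (hp : p ∈ 𝒩) : AELt (p (x - y)) r := by
  obtain ⟨s, hs, hsr⟩ := h
  exact AELt.of_le_of_lt (hs.1 ⟨p, hp, rfl⟩) hsr

theorem mem_seminormBall_of_max {x y : E} {𝒩 : Set (E → L0 P)} {r : L0 P} {p : E → L0 P}
    (hp : p ∈ 𝒩) (hmax : ∀ q ∈ 𝒩, q (x - y) ≤ p (x - y)) (h : AELt (p (x - y)) r) :
    y ∈ seminormBall x 𝒩 r := by
  refine ⟨p (x - y), IsGreatest.isLUB ⟨⟨p, hp, rfl⟩, ?_⟩, h⟩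
  rintro _ ⟨q, hq, rfl⟩
  exact hmax q hq

theorem mem_seminormBall_singleton {x y : E} {r : L0 P} {p : E → L0 P} :
    y ∈ seminormBall x {p} r ↔ AELt (p (x - y)) r := by
  refine ⟨fun h => aeLt_of_mem_seminormBall h rfl, fun h => mem_seminormBall_of_max rfl ?_ h⟩
  rintro q rfl
  exact le_rfl

theorem seminormBall_finite {x : E} {𝒩 : Set (E → L0 P)} (hfin : 𝒩.Finite) (hne : 𝒩.Nonempty)
    (r : L0 P) : seminormBall x 𝒩 r = ⋂ p ∈ 𝒩, seminormBall x {p} r := by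
  classical
  ext y
  simp only [Set.mem_iInter, mem_seminormBall_singleton]
  refine ⟨fun h p hp => aeLt_of_mem_seminormBall h hp, fun h => ?_⟩
  have hne' : hfin.toFinset.Nonempty := by simpa using hne
  refine ⟨hfin.toFinset.sup' hne' fun p => p (x - y), ⟨?_, fun b hb => ?_⟩, ?_⟩
  · rintro _ ⟨p, hp, rfl⟩
    exact Finset.le_sup' (fun p : E → L0 P => p (x - y)) (hfin.mem_toFinset.mpr hp)
  · refine Finset.sup'_le _ _ fun p hp => hb ⟨p, hfin.mem_toFinset.mp hp, rfl⟩
  · refine Finset.sup'_induction (p := fun a => AELt a r) hne' _ (fun a ha b hb => ?_)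
      fun p hp => h p (hfin.mem_toFinset.mp hp)
    filter_upwards [ha, hb, AEEqFun.coeFn_sup a b] with ω h1 h2 h3
    rw [h3]
    exact sup_lt_iff.mpr ⟨h1, h2⟩

theorem coeFn_natOne : ∀ᵐ ω ∂P, (1 : L0Nat P) ω = 1 := AEEqFun.coeFn_one

theorem eq_of_forall_ind_mul (A : Partition Ω) {a b : L0 P}
    (h : ∀ k, ind P (A.part k) * a = ind P (A.part k) * b) : a = b := by
  obtain ⟨m, hm⟩ := exists_index (P := P) A
  rw [eq_iff_ae]
  filter_upwards [hm, ae_all_iff.mpr fun k => ae_eq_of_ind_mul (h k)] with ω h1 h2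
  exact h2 _ h1

omit [AddCommGroup E] in
theorem isStableFinite_singleton (p : E → L0 P) : IsStableFinite ({p} : Set (E → L0 P)) := by
  refine ⟨⟨Set.singleton_nonempty p, fun A x z hx hz => ?_⟩, 1, fun _ => p, ?_, ?_⟩
  · funext y
    refine eq_of_forall_ind_mul A fun k => ?_
    rw [hz k y, hx k]
  · refine ⟨fun _ _ => rfl, fun a ha b hb _ => ?_, ?_⟩
    · exact (le_antisymm ha.2 ha.1).trans (le_antisymm hb.2 hb.1).symm
    · rintro q rfl
      exact ⟨1, ⟨le_rfl, le_rfl⟩, rfl⟩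
  · exact fun A x z _ _ _ k y => rfl

/-- A finite family need not be stable finite, but its ball is a finite intersection of balls of
single seminorms, and singletons are stable finite. -/
theorem topStable_le_topZero (𝒬 : Set (E → L0 P)) : topStable 𝒬 ≤ topZero 𝒬 := by
  refine le_generateFrom ?_
  rintro _ ⟨x, 𝒩, r, h𝒩, hfin, hne, hr, rfl⟩
  rw [seminormBall_finite hfin hne]
  let := topStable 𝒬
  exact hfin.isOpen_biInter fun p hp => TopologicalSpace.isOpen_generateFrom_of_mem
    ⟨x, {p}, r, Set.singleton_subset_iff.mpr (h𝒩 hp), isStableFinite_singleton p, hr, rfl⟩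

theorem isOpen_seminormBall_singleton {𝒬 : Set (E → L0 P)} {p : E → L0 P} (hp : p ∈ 𝒬) (x : E)
    {r : L0 P} (hr : AELt 0 r) : IsOpen[topZero 𝒬] (seminormBall x {p} r) :=
  TopologicalSpace.isOpen_generateFrom_of_mem
    ⟨x, {p}, r, Set.singleton_subset_iff.mpr hp, Set.finite_singleton p,
      Set.singleton_nonempty p, hr, rfl⟩

theorem seminormBall_mem_nhds {𝒬 : Set (E → L0 P)} {p : E → L0 P} (hp : p ∈ 𝒬) (hp0 : p 0 = 0)
    (z : E) {r : L0 P} (hr : AELt 0 r) :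
    seminormBall z {p} r ∈ @nhds E (topZero 𝒬) z := by
  let := topZero 𝒬
  refine (isOpen_seminormBall_singleton hp z hr).mem_nhds ?_
  rw [mem_seminormBall_singleton, sub_self, hp0]
  exact hr

theorem nhds_topStable_le (𝒬 : Set (E → L0 P)) (z : E) :
    @nhds E (topStable 𝒬) z ≤ @nhds E (topZero 𝒬) z :=
  nhds_mono (topStable_le_topZero 𝒬)

omit [AddCommGroup E] in
/-- A stable finite set is locally given by finitely many of its members. -/
theorem IsStableFinite.exists_finset {𝒩 : Set (E → L0 P)} (h : IsStableFinite 𝒩) :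
    ∃ (F : ℕ → Finset (E → L0 P)) (n : L0Nat P), (∀ k, ∀ q ∈ F k, q ∈ 𝒩) ∧
      (∀ p ∈ 𝒩, ∀ x, ∀ᵐ ω ∂P, ∃ q ∈ F (n ω), p x ω = q x ω) ∧
      ∀ x, ∃ p ∈ 𝒩, ∀ᵐ ω ∂P, ∀ q ∈ F (n ω), q x ω ≤ p x ω := by
  classical
  obtain ⟨⟨⟨p0, hp0⟩, -⟩, n, φ, hφ, hst⟩ := h
  have hn : (1 : L0Nat P) ≤ n := by
    obtain ⟨m, hm, -⟩ := hφ.2.2 hp0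
    exact hm.1.trans hm.2
  -- Capping the constant `j + 1` at `n` keeps it in `{1 ≤ m ≤ n}`. Every `m` there agrees at ω with
  -- `c (m ω - 1)`; the shift reflects that the interval starts at 1.
  let c : ℕ → L0Nat P := fun j => AEEqFun.const Ω (j + 1) ⊓ n
  have hc : ∀ j, ∀ᵐ ω ∂P, c j ω = min (j + 1) (n ω) := fun j => by
    filter_upwards [AEEqFun.coeFn_inf (AEEqFun.const Ω (j + 1) : L0Nat P) n,
      coeFn_cst (P := P) (j + 1)] with ω h1 h2
    rw [h1, h2]
  have hcmem : ∀ j, c j ∈ natInterval n := fun j => by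
    refine ⟨?_, inf_le_right⟩
    rw [le_iff_ae] at hn ⊢
    filter_upwards [hn, hc j, coeFn_natOne (P := P)] with ω h1 h2 h3
    rw [h3] at h1 ⊢
    rw [h2]
    omega
  have hloc : ∀ m ∈ natInterval n, ∀ x, ∀ᵐ ω ∂P, φ m x ω = φ (c (m ω - 1)) x ω := by
    intro m hm x
    have h1 := hst (levelPartition m) (fun j => c (j - 1)) m (fun j => hcmem _) hm fun j => by
      filter_upwards [hc (j - 1), le_iff_ae.mp hm.1, le_iff_ae.mp hm.2,
        coeFn_natOne (P := P)] with ω h1 h2 h3 h4 h5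
      rw [h4] at h2
      have h6 : m ω = j := h5
      rw [h1]
      omega
    filter_upwards [ae_all_iff.mpr fun k => ae_eq_of_ind_mul (h1 k x)] with ω h2
    exact h2 (m ω) rfl
  refine ⟨fun k => (Finset.range k).image fun j => φ (c j), n, ?_, fun p hp x => ?_, fun x => ?_⟩
  · intro k q hq
    obtain ⟨j, -, rfl⟩ := Finset.mem_image.mp hq
    exact hφ.1 (hcmem j)
  · obtain ⟨m, hm, rfl⟩ := hφ.2.2 hp
    filter_upwards [hloc m hm x, le_iff_ae.mp hm.1, le_iff_ae.mp hm.2,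
        coeFn_natOne (P := P)] with ω h1 h2 h3 h4
    rw [h4] at h2
    exact ⟨_, Finset.mem_image_of_mem _ (Finset.mem_range.mpr (show m ω - 1 < n ω by omega)), h1⟩
  -- A measurable argmax. Stability of `φ` turns the random index into a single member of `𝒩` that
  -- dominates the others at `x`.
  · obtain ⟨m, hm⟩ := exists_nat_select (P := P)
      (p := fun i ω => (1 ≤ i ∧ i ≤ n ω) ∧ ∀ j, j < n ω → φ (c j) x ω ≤ φ (c (i - 1)) x ω)
      (fun i => by
        have hnm := measurable_coe_nat n
        refine MeasurableSet.inter (MeasurableSet.inter (MeasurableSet.const _)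
          (measurableSet_le measurable_const hnm)) ?_
        have : {ω | ∀ j, j < n ω → φ (c j) x ω ≤ φ (c (i - 1)) x ω} =
            ⋂ j, ({ω | j < n ω}ᶜ ∪ {ω | φ (c j) x ω ≤ φ (c (i - 1)) x ω}) := by
          ext ω
          simp [imp_iff_not_or]
        change MeasurableSet {ω | ∀ j, j < n ω → φ (c j) x ω ≤ φ (c (i - 1)) x ω}
        rw [this]
        refine MeasurableSet.iInter fun j => ?_
        exact (measurableSet_lt measurable_const hnm).compl.union
          (measurableSet_le (measurable_coe _) (measurable_coe _)))
      (by
        filter_upwards [le_iff_ae.mp hn, coeFn_natOne (P := P)] with ω h1 h2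
        rw [h2] at h1
        obtain ⟨i, hi, himax⟩ := Finset.exists_max_image (Finset.range (n ω))
          (fun j => φ (c j) x ω) ⟨0, Finset.mem_range.mpr h1⟩
        rw [Finset.mem_range] at hi
        exact ⟨i + 1, ⟨by omega, by omega⟩, fun j hj => himax j (Finset.mem_range.mpr hj)⟩)
    have hmem : m ∈ natInterval n := by
      constructor <;> rw [le_iff_ae]
      · filter_upwards [hm, coeFn_natOne (P := P)] with ω h1 h2
        rw [h2]
        exact h1.1.1
      · filter_upwards [hm] with ω h1 using h1.1.2
    refine ⟨φ m, hφ.1 hmem, ?_⟩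
    filter_upwards [hm, hloc m hmem x] with ω h1 h2 q hq
    obtain ⟨j, hj, rfl⟩ := Finset.mem_image.mp hq
    rw [h2]
    exact h1.2 j (Finset.mem_range.mp hj)

theorem exists_pos_sub {s r : L0 P} (h : AELt s r) :
    ∃ δ : L0 P, AELt 0 δ ∧ ∀ᵐ ω ∂P, δ ω = r ω - s ω := by
  refine ⟨r - s, ?_, coeFn_sub r s⟩
  filter_upwards [h, coeFn_sub r s, coeFn_zero (P := P)] with ω h1 h2 h3
  rw [h2, h3]
  linarith

/-- Neighbourhoods for the stable topology contain sets that are locally given by finitely many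
seminorms. -/
theorem exists_of_mem_nhds_topStable {𝒬 : Set (E → L0 P)}
    (h𝒬 : ∀ p ∈ 𝒬, ∀ x y, p (x + y) ≤ p x + p y) {z : E} {U : Set E}
    (hU : U ∈ @nhds E (topStable 𝒬) z) :
    ∃ (F : ℕ → Finset (E → L0 P)) (n : L0Nat P) (r : L0 P), (∀ k, ∀ q ∈ F k, q ∈ 𝒬) ∧ AELt 0 r ∧
      ∀ a, (∀ᵐ ω ∂P, ∀ q ∈ F (n ω), q (z - a) ω < r ω) → a ∈ U := by
  classical
  -- The sets satisfying the conclusion form a filter (two local families are merged by pairing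
  -- their indices), so only subbasic neighbourhoods need checking.
  let G : Filter E :=
    { sets := {U | ∃ (F : ℕ → Finset (E → L0 P)) (n : L0Nat P) (r : L0 P),
        (∀ k, ∀ q ∈ F k, q ∈ 𝒬) ∧ AELt 0 r ∧
          ∀ a, (∀ᵐ ω ∂P, ∀ q ∈ F (n ω), q (z - a) ω < r ω) → a ∈ U}
      univ_sets := ⟨fun _ => ∅, 0, 1, by simp, isPosUnit_iff.mp IsPosUnit.one, by simp⟩
      sets_of_superset := by
        rintro U V ⟨F, n, r, hF, hr, h⟩ hUV
        exact ⟨F, n, r, hF, hr, fun a ha => hUV (h a ha)⟩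
      inter_sets := by
        rintro U V ⟨F, n, r, hF, hr, h⟩ ⟨F', n', r', hF', hr', h'⟩
        obtain ⟨m, hm⟩ := exists_mk (P := P) (β := ℕ) (g := fun ω => Nat.pair (n ω) (n' ω))
          (by
            have h1 : Measurable fun p : ℕ × ℕ => Nat.pair p.1 p.2 := .of_discrete
            exact h1.comp ((measurable_coe_nat n).prodMk (measurable_coe_nat n')))
        refine ⟨fun k => F k.unpair.1 ∪ F' k.unpair.2, m, r ⊓ r', fun k q hq => ?_, ?_,
          fun a ha => ⟨h a ?_, h' a ?_⟩⟩
        · rcases Finset.mem_union.mp hq with hq | hq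
          · exact hF _ q hq
          · exact hF' _ q hq
        · filter_upwards [hr, hr', AEEqFun.coeFn_inf r r'] with ω h1 h2 h3
          rw [h3]
          exact lt_inf_iff.mpr ⟨h1, h2⟩
        · filter_upwards [ha, hm, AEEqFun.coeFn_inf r r'] with ω h1 h2 h3 q hq
          refine (h1 q (Finset.mem_union_left _ ?_)).trans_le (h3 ▸ inf_le_left)
          simpa [h2] using hq
        · filter_upwards [ha, hm, AEEqFun.coeFn_inf r r'] with ω h1 h2 h3 q hq
          refine (h1 q (Finset.mem_union_right _ ?_)).trans_le (h3 ▸ inf_le_right)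
          simpa [h2] using hq }
  have hG : G ≤ @nhds E (topStable 𝒬) z := by
    rw [TopologicalSpace.nhds_generateFrom]
    refine le_iInf₂ fun s hs => le_principal_iff.mpr ?_
    obtain ⟨hzs, x, 𝒩, r, h𝒩, hfin, hr, rfl⟩ := hs
    obtain ⟨s, hs, hsr⟩ := hzs
    obtain ⟨F, n, hF, hF1, hF2⟩ := hfin.exists_finset
    obtain ⟨δ, hδ, hδ'⟩ := exists_pos_sub hsr
    refine ⟨F, n, δ, fun k q hq => h𝒩 (hF k q hq), hδ, fun a ha => ?_⟩
    obtain ⟨p, hp, hpmax⟩ := hF2 (x - a)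
    refine mem_seminormBall_of_max hp (fun q hq => ?_) ?_
    · rw [le_iff_ae]
      filter_upwards [hF1 q hq (x - a), hpmax] with ω h1 h2
      obtain ⟨q', hq', h3⟩ := h1
      rw [h3]
      exact h2 q' hq'
    · have h3 : ∀ᵐ ω ∂P, ∀ k, ∀ q ∈ F k, q (x - a) ω ≤ s ω + q (z - a) ω := by
        refine ae_all_iff.mpr fun k => (Finset.eventually_all _).mpr fun q hq => ?_
        have h4 : x - a = (x - z) + (z - a) := by abel
        filter_upwards [le_iff_ae.mp (h𝒬 q (h𝒩 (hF k q hq)) (x - z) (z - a)),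
          coeFn_add (q (x - z)) (q (z - a)),
          le_iff_ae.mp (hs.1 ⟨q, hF k q hq, rfl⟩)] with ω h1 h2 h3
        rw [h4]
        rw [h2] at h1
        exact h1.trans (add_le_add h3 le_rfl)
      filter_upwards [h3, ha, hF1 p hp (x - a), hδ'] with ω h1 h2 h4 h5
      obtain ⟨q, hq, h6⟩ := h4
      rw [h6]
      linarith [h1 _ q hq, h2 q hq]
  exact hG hU

end Topology

/-! ### The dual as multiples of its unit ball -/

section Dual

variable {Ω : Type*} [MeasurableSpace Ω] {P : Measure Ω}
  {E : Type*} [AddCommGroup E] [Module (L0 P) E]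

theorem dualBall_subset_dual {N : E → L0 P} (hN : IsL0Norm N) : dualBall N ⊆ dual N := by
  intro f hf
  let := topZero ({N} : Set (E → L0 P))
  refine continuous_generateFrom_iff.mpr ?_
  rintro _ ⟨x, 𝒩, r, h𝒩, -, hne, hr, rfl⟩
  obtain rfl : 𝒩 = {fun r : L0 P => |r|} := hne.subset_singleton_iff.mp h𝒩
  rw [isOpen_iff_mem_nhds]
  intro y hy
  rw [Set.mem_preimage, mem_seminormBall_singleton] at hy
  obtain ⟨δ, hδ, hδ'⟩ := exists_pos_sub hy
  refine mem_of_superset (seminormBall_mem_nhds (Set.mem_singleton N) hN.zero y hδ) fun a ha => ?_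
  rw [mem_seminormBall_singleton] at ha
  rw [Set.mem_preimage, mem_seminormBall_singleton]
  filter_upwards [ha, hδ', dualBall_sub_ae hf y a, coeFn_abs (x - f y), coeFn_sub x (f y),
    coeFn_abs (x - f a), coeFn_sub x (f a)] with ω h1 h2 h3 h4 h5 h6 h7
  rw [h6, h7]
  rw [h4, h5] at h2
  have := abs_sub_le (x ω) (f y ω) (f a ω)
  linarith

/-- Continuity at 0 gives a random radius `r` with `|f x| < 1` whenever `N x < r` a.e.; rescaling
`x` by a random factor then yields the bound with `C = 2 / r`. -/
theorem exists_bound_of_mem_dual {N : E → L0 P} (hN : IsL0Norm N) {f : E →ₗ[L0 P] L0 P}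
    (hf : f ∈ dual N) : ∃ C : L0 P, AELt 0 C ∧ ∀ x, ∀ᵐ ω ∂P, |f x ω| ≤ C ω * N x ω := by
  have hV : seminormBall (0 : L0 P) {fun r : L0 P => |r|} 1 ∈
      @nhds (L0 P) (topZero {fun r : L0 P => |r|}) (f 0) := by
    rw [map_zero]
    exact seminormBall_mem_nhds (Set.mem_singleton _) abs_zero 0 (isPosUnit_iff.mp IsPosUnit.one)
  have hU := nhds_topStable_le _ _ ((@Continuous.tendsto E (L0 P) (topZero {N})
    (topZero {fun r : L0 P => |r|}) f hf 0).eventually hV)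
  obtain ⟨F, n, r, hF, hr, h⟩ := exists_of_mem_nhds_topStable
    (by rintro p rfl; exact hN.add_le) hU
  have h1 : ∀ x, AELt (N x) r → ∀ᵐ ω ∂P, |f x ω| < 1 := fun x hx => by
    have h2 := h x (by
      filter_upwards [hx] with ω h2 q hq
      obtain rfl : q = N := hF _ q hq
      rwa [zero_sub, hN.neg])
    replace h2 : f x ∈ seminormBall (0 : L0 P) {fun r : L0 P => |r|} 1 := h2
    rw [mem_seminormBall_singleton] at h2
    filter_upwards [h2, coeFn_abs (0 - f x), coeFn_one (P := P), coeFn_sub 0 (f x),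
      coeFn_zero (P := P)] with ω h3 h4 h5 h6 h7
    rwa [h4, h5, h6, h7, zero_sub, abs_neg] at h3
  obtain ⟨C, hC⟩ := exists_mk (P := P) (g := fun ω => 2 / r ω) (measurable_coe r |>.const_div 2)
  refine ⟨C, ?_, fun x => ?_⟩
  · filter_upwards [hr, hC, coeFn_zero (P := P)] with ω h2 h3 h4
    rw [h4] at h2 ⊢
    rw [h3]
    positivity
  · have h2 : ∀ᵐ ω ∂P, ∀ k : ℕ, |f x ω| ≤ C ω * (N x ω + 1 / (k + 1)) := by
      refine ae_all_iff.mpr fun k => ?_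
      -- The summand `1 / (k + 1)` keeps the denominator positive where `N x` vanishes; it
      -- disappears as `k` tends to infinity.
      obtain ⟨t, ht⟩ := exists_mk (P := P) (g := fun ω => r ω / (2 * (N x ω + 1 / (k + 1))))
        ((measurable_coe r).div (((measurable_coe (N x)).add_const _).const_mul 2))
      have hN0 : ∀ᵐ ω ∂P, 0 ≤ N x ω := by
        filter_upwards [le_iff_ae.mp (hN.nonneg x), coeFn_zero (P := P)] with ω h3 h4
        rwa [← h4]
      have hk : (0 : ℝ) < 1 / (k + 1) := Nat.one_div_pos_of_nat
      have ht0 : ∀ᵐ ω ∂P, 0 < t ω := by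
        filter_upwards [ht, hN0, hr, coeFn_zero (P := P)] with ω h3 h4 h5 h6
        rw [h6] at h5
        rw [h3]
        positivity
      have h3 := h1 (t • x) (by
        rw [hN.smul]
        filter_upwards [ht, hN0, hr, coeFn_zero (P := P), ht0, coeFn_mul |t| (N x),
          coeFn_abs t] with ω h3 h4 h5 h6 h7 h8 h9
        rw [h6] at h5
        rw [h8, h9, abs_of_pos h7, h3, div_mul_eq_mul_div, div_lt_iff₀ (by positivity)]
        nlinarith [mul_pos h5 hk, mul_nonneg h5.le h4])
      filter_upwards [h3, ht, hN0, hr, coeFn_zero (P := P), ht0, coeFn_mul t (f x), hC] with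
        ω h3 h4 h5 h6 h7 h8 h9 h10
      rw [h7] at h6
      rw [map_smul, smul_eq_mul, h9, abs_mul, abs_of_pos h8, h4, div_mul_eq_mul_div,
        div_lt_one (by positivity)] at h3
      rw [h10, div_mul_eq_mul_div, le_div_iff₀ h6]
      linarith
    filter_upwards [h2] with ω h3
    have h4 : Tendsto (fun k : ℕ => C ω * (N x ω + 1 / ((k : ℝ) + 1))) atTop
        (𝓝 (C ω * (N x ω + 0))) :=
      (tendsto_const_nhds.add tendsto_one_div_add_atTop_nhds_zero_nat).const_mul _
    rw [add_zero] at h4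
    exact ge_of_tendsto' h4 h3

/-- Members of the dual are multiples of members of the dual unit ball. -/
theorem exists_dualBall_of_mem_dual {N : E → L0 P} (hN : IsL0Norm N) {f : E →ₗ[L0 P] L0 P}
    (hf : f ∈ dual N) : ∃ g ∈ dualBall N, ∃ C : L0 P, AELt 0 C ∧
      ∀ x, ∀ᵐ ω ∂P, f x ω = C ω * g x ω := by
  obtain ⟨C, hC, h⟩ := exists_bound_of_mem_dual hN hf
  obtain ⟨s, -, hCs⟩ := exists_pos_inv hC
  have hCs' : ∀ᵐ ω ∂P, C ω * s ω = 1 := by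
    filter_upwards [coeFn_mul C s, coeFn_one (P := P)] with ω h1 h2
    rw [← h1, hCs, h2]
  refine ⟨s • f, fun x => ?_, C, hC, fun x => ?_⟩
  · rw [le_iff_ae]
    filter_upwards [hC, hCs', h x, coeFn_abs ((s • f) x), coeFn_mul s (f x),
      coeFn_zero (P := P)] with ω h1 h2 h3 h4 h5 h6
    rw [h6] at h1
    rw [h4, LinearMap.smul_apply, smul_eq_mul, h5]
    have h7 : 0 < s ω := (mul_pos_iff_of_pos_left h1).mp (by rw [h2]; exact one_pos)
    calc |s ω * f x ω| = s ω * |f x ω| := by rw [abs_mul, abs_of_pos h7]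
      _ ≤ s ω * (C ω * N x ω) := mul_le_mul_of_nonneg_left h3 h7.le
      _ = (C ω * s ω) * N x ω := by ring
      _ = N x ω := by rw [h2, one_mul]
  · filter_upwards [hCs', coeFn_mul s (f x)] with ω h2 h5
    rw [LinearMap.smul_apply, smul_eq_mul, h5, ← mul_assoc, h2, one_mul]

theorem abs_mem_weakSeminorms {N : E → L0 P} {f : E →ₗ[L0 P] L0 P} (hf : f ∈ dual N) :
    (fun x => |f x|) ∈ weakSeminorms N := ⟨f, hf, rfl⟩

/-- Neighbourhoods for the weak stable topology contain sets that are locally given by finitely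
many functionals. -/
theorem exists_of_mem_nhds_weakStable {N : E → L0 P} {z : E} {U : Set E}
    (hU : U ∈ @nhds E (weakStable N) z) :
    ∃ (F : ℕ → Finset (E →ₗ[L0 P] L0 P)) (n : L0Nat P) (r : L0 P), (∀ k, ∀ f ∈ F k, f ∈ dual N) ∧
      AELt 0 r ∧ ∀ a, (∀ᵐ ω ∂P, ∀ f ∈ F (n ω), |f z ω - f a ω| < r ω) → a ∈ U := by
  classical
  obtain ⟨F, n, r, hF, hr, h⟩ := exists_of_mem_nhds_topStable (by
    rintro _ ⟨f, -, rfl⟩ x y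
    simp only [map_add]
    rw [abs_le']
    have h1 : ∀ a b : L0 P, a + b ≤ |a| + |b| := fun a b =>
      add_le_add (le_abs_self a) (le_abs_self b)
    refine ⟨h1 _ _, ?_⟩
    have := h1 (-f x) (-f y)
    rwa [abs_neg, abs_neg, ← neg_add] at this) hU
  choose! g hg hg' using hF
  refine ⟨fun k => (F k).image (g k), n, r, fun k f hf => ?_, hr, fun a ha => h a ?_⟩
  · obtain ⟨q, hq, rfl⟩ := Finset.mem_image.mp hf
    exact hg k q hq
  · have h1 : ∀ᵐ ω ∂P, ∀ k, ∀ q ∈ F k, q (z - a) ω = |g k q z ω - g k q a ω| := by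
      refine ae_all_iff.mpr fun k => (Finset.eventually_all _).mpr fun q hq => ?_
      filter_upwards [coeFn_abs (g k q (z - a)), coeFn_sub (g k q z) (g k q a)] with ω h1 h2
      conv_lhs => rw [hg' k q hq]
      rw [h1, map_sub, h2]
    filter_upwards [h1, ha] with ω h2 h3 q hq
    rw [h2 _ q hq]
    exact h3 _ (Finset.mem_image_of_mem _ hq)

end Dual

/-! ### Stable sequences and random subsequences -/

section Sequences

variable {Ω : Type*} [MeasurableSpace Ω] {P : Measure Ω}
  {E : Type*} [AddCommGroup E] [Module (L0 P) E]

theorem isConcat_const (k : L0Nat P) :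
    IsConcat (NatEq P) (levelPartition k) (fun i => AEEqFun.const Ω i) k := fun i => by
  filter_upwards [coeFn_cst (P := P) i] with ω h1 h2
  rw [h1]
  exact h2

/-- A random index is the concatenation of constants along its level sets, so the values at
constants determine a stable sequence. -/
theorem IsStableSeq.eval {y : L0Nat P → E} (hy : IsStableSeq y) {g : E → L0 P} (hg : IsLocal g)
    (k : L0Nat P) : ∀ᵐ ω ∂P, g (y k) ω = g (y (AEEqFun.const Ω (k ω))) ω :=
  hg.isConcat (x := fun i => y (AEEqFun.const Ω i))
    (hy (levelPartition k) _ k (fun _ => trivial) trivial (isConcat_const k))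

theorem isStableSeq_cat {N : E → L0 P} (hN : IsL0Norm N) (hE : IsStableModule P E) (x : ℕ → E) :
    IsStableSeq (cat hE x) := by
  intro A k l _ _ hkl i
  rw [modEq_iff_ae hN]
  -- Locality is available only with the other argument fixed; treating all `x j` at once allows the
  -- substitution `j = l i ω` afterwards.
  have h1 : ∀ᵐ ω ∂P, ∀ j, N (x j - cat hE x (k i)) ω = N (x j - x (k i ω)) ω := by
    refine ae_all_iff.mpr fun j => ?_
    filter_upwards [(hN.isLocal_sub (x j)).cat hE x (k i)] with ω h1
    rw [hN.sub_comm, h1, hN.sub_comm]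
  filter_upwards [h1, (hN.isLocal_sub (cat hE x (k i))).cat hE x l, hkl i,
    coeFn_zero (P := P)] with ω h1 h2 h3 h4 hA
  rw [h2, h1, h3 hA, sub_self, hN.zero, h4]

/-- The net provides a random threshold `k0`. A constant `i` need not exceed it everywhere, but `k0
⊔ i` does, and it equals `i` wherever `k0 ω ≤ i`. -/
theorem tendsto_ae_of_tendsto_weakZero {N : E → L0 P} {y : L0Nat P → E} (hy : IsStableSeq y) {z : E}
    (h : Tendsto y atTop (@nhds E (weakZero N) z)) {f : E →ₗ[L0 P] L0 P} (hf : f ∈ dual N) :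
    ∀ᵐ ω ∂P, Tendsto (fun i : ℕ => f (y (AEEqFun.const Ω i)) ω) atTop (𝓝 (f z ω)) := by
  have h1 : ∀ᵐ ω ∂P, ∀ l : ℕ, ∃ k0 : ℕ, ∀ i ≥ k0,
      |f z ω - f (y (AEEqFun.const Ω i)) ω| < 1 / ((l : ℝ) + 1) := by
    refine ae_all_iff.mpr fun l => ?_
    let r : L0 P := AEEqFun.const Ω (1 / ((l : ℝ) + 1))
    have hr : AELt 0 r := by
      filter_upwards [coeFn_zero (P := P), coeFn_cst (P := P) (1 / ((l : ℝ) + 1))] with ω h1 h2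
      rw [h1, h2]
      positivity
    obtain ⟨k0, hk0⟩ := eventually_atTop.mp (h (seminormBall_mem_nhds (abs_mem_weakSeminorms hf)
      (by simp) z hr))
    have h2 : ∀ᵐ ω ∂P, ∀ i, k0 ω ≤ i →
        |f z ω - f (y (AEEqFun.const Ω i)) ω| < 1 / ((l : ℝ) + 1) := by
      refine ae_all_iff.mpr fun i => ?_
      have h3 := hk0 (k0 ⊔ AEEqFun.const Ω i) le_sup_left
      rw [mem_seminormBall_singleton] at h3
      filter_upwards [h3, coeFn_cst (P := P) (1 / ((l : ℝ) + 1)),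
        AEEqFun.coeFn_sup k0 (AEEqFun.const Ω i), coeFn_cst (P := P) i,
        hy.eval (isLocal_linearMap f) (k0 ⊔ AEEqFun.const Ω i),
        coeFn_abs (f (z - y (k0 ⊔ AEEqFun.const Ω i))),
        coeFn_sub (f z) (f (y (k0 ⊔ AEEqFun.const Ω i)))] with ω h3 h4 h5 h6 h7 h8 h9 h10
      rw [h8, map_sub, h9, h7, h5, h6, sup_eq_right.mpr h10] at h3
      exact h3.trans_eq h4
    filter_upwards [h2] with ω h3 using ⟨k0 ω, h3⟩
  filter_upwards [h1] with ω h2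
  rw [Metric.tendsto_atTop]
  intro ε hε
  obtain ⟨l, hl⟩ := exists_nat_one_div_lt hε
  obtain ⟨k0, hk0⟩ := h2 l
  refine ⟨k0, fun i hi => ?_⟩
  rw [Real.dist_eq, abs_sub_comm]
  exact (hk0 i hi).trans hl

/-- A stable neighbourhood involves countably many functionals, hence one null set, and finitely
many at each ω, hence a finite threshold there. The threshold is selected measurably and serves as
the index for the net. -/
theorem tendsto_weakStable_of_tendsto_ae {N : E → L0 P} {y : L0Nat P → E} (hy : IsStableSeq y)
    {z : E} (h : ∀ f ∈ dual N, ∀ᵐ ω ∂P,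
      Tendsto (fun i : ℕ => f (y (AEEqFun.const Ω i)) ω) atTop (𝓝 (f z ω))) :
    Tendsto y atTop (@nhds E (weakStable N) z) := by
  intro U hU
  obtain ⟨F, n, r, hF, hr, hFU⟩ := exists_of_mem_nhds_weakStable hU
  have h1 : ∀ᵐ ω ∂P, ∀ k, ∀ f ∈ F k,
      Tendsto (fun i : ℕ => f (y (AEEqFun.const Ω i)) ω) atTop (𝓝 (f z ω)) :=
    ae_all_iff.mpr fun k => (Finset.eventually_all _).mpr fun f hf => h f (hF k f hf)
  obtain ⟨k0, hk0⟩ := exists_nat_select (P := P)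
    (p := fun k ω => ∀ i, k ≤ i → ∀ m, ∀ f ∈ F m, n ω = m →
      |f z ω - f (y (AEEqFun.const Ω i)) ω| < r ω)
    (fun k => by
      have : {ω | ∀ i, k ≤ i → ∀ m, ∀ f ∈ F m, n ω = m →
            |f z ω - f (y (AEEqFun.const Ω i)) ω| < r ω} =
          ⋂ i, ⋂ (_ : k ≤ i), ⋂ m, ⋂ f ∈ F m, ({ω | n ω = m}ᶜ ∪
            {ω | |f z ω - f (y (AEEqFun.const Ω i)) ω| < r ω}) := by
        ext ω
        simp [imp_iff_not_or]
      rw [this]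
      refine MeasurableSet.iInter fun i => MeasurableSet.iInter fun _ => MeasurableSet.iInter
        fun m => Finset.measurableSet_biInter _ fun f _ => MeasurableSet.union ?_ ?_
      · exact (measurable_coe_nat n (measurableSet_singleton m)).compl
      · exact measurableSet_lt (((measurable_coe _).sub (measurable_coe _)).abs)
          (measurable_coe _))
    (by
      filter_upwards [h1, hr, coeFn_zero (P := P)] with ω h1 h2 h3
      rw [h3] at h2
      have h4 : ∀ᶠ i : ℕ in atTop, ∀ f ∈ F (n ω),
          |f z ω - f (y (AEEqFun.const Ω i)) ω| < r ω := by
        refine (Finset.eventually_all _).mpr fun f hf => ?_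
        filter_upwards [Metric.tendsto_nhds.mp (h1 _ f hf) (r ω) h2] with i hi
        rwa [Real.dist_eq, abs_sub_comm] at hi
      obtain ⟨k, hk⟩ := eventually_atTop.mp h4
      refine ⟨k, fun i hi m f hf hm => hk i hi f (hm ▸ hf)⟩)
  refine mem_atTop_sets.mpr ⟨k0, fun k hk => hFU _ ?_⟩
  have h2 : ∀ᵐ ω ∂P, ∀ m, ∀ f ∈ F m, f (y k) ω = f (y (AEEqFun.const Ω (k ω))) ω :=
    ae_all_iff.mpr fun m => (Finset.eventually_all _).mpr fun f hf =>
      hy.eval (isLocal_linearMap f) k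
  filter_upwards [hk0, le_iff_ae.mp hk, h2] with ω h3 h4 h5 f hf
  rw [h5 _ f hf]
  exact h3 _ h4 _ f hf rfl

/-- Random subsequential compactness in terms of sequences indexed by `ℕ`. -/
def IsRandomSeqCompact (N : E → L0 P) (S : Set E) : Prop :=
  ∀ x : ℕ → E, (∀ i, x i ∈ S) → ∃ ν : ℕ → L0Nat P, (∀ i, AELt (ν i) (ν (i + 1))) ∧ ∃ z ∈ S,
    ∀ f ∈ dual N, ∀ᵐ ω ∂P, Tendsto (fun i => f (x (ν i ω)) ω) atTop (𝓝 (f z ω))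

theorem IsStableSubseq.isStableSeq {x y : L0Nat P → E} (hx : IsStableSeq x)
    (h : IsStableSubseq (P := P) y x) : IsStableSeq y := by
  obtain ⟨ν, hν, -, hy⟩ := h
  obtain rfl : y = fun k => x (ν k) := funext hy
  exact fun A k l _ _ hkl => hx A _ _ (fun _ => trivial) trivial
    (hν A k l (fun _ => trivial) trivial hkl)

/-- Random evaluation extends a sequence to a stable one; the subsequence is then read off at
constant indices. -/
theorem IsStableSeqCompact.isRandomSeqCompact {N : E → L0 P} (hN : IsL0Norm N)
    (hE : IsStableModule P E) {S : Set E} (hS : IsStableSet (ModEq P E) S)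
    (h : IsStableSeqCompact P (weakZero N) S) : IsRandomSeqCompact N S := by
  intro x hx
  have hX := isStableSeq_cat hN hE x
  obtain ⟨y, hyx, z, hz, hyz⟩ := h (cat hE x) hX (cat_mem hE hS hx)
  have hy := hyx.isStableSeq hX
  obtain ⟨ν, -, hνlt, hν⟩ := hyx
  refine ⟨fun i => ν (AEEqFun.const Ω i), fun i => hνlt _ _ ?_, z, hz, fun f hf => ?_⟩
  · filter_upwards [coeFn_cst (P := P) i, coeFn_cst (P := P) (i + 1)] with ω h1 h2
    rw [h1, h2]
    exact i.lt_succ_self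
  · have h1 : ∀ᵐ ω ∂P, ∀ i : ℕ, f (y (AEEqFun.const Ω i)) ω = f (x (ν (AEEqFun.const Ω i) ω)) ω :=
      ae_all_iff.mpr fun i => by
        rw [hν]
        exact (isLocal_linearMap f).cat hE x _
    filter_upwards [h1, tendsto_ae_of_tendsto_weakZero hy hyz hf] with ω h2 h3
    simpa only [h2] using h3

/-- Random evaluation of `ν` makes it a stable index sequence, and strict monotonicity survives
pointwise. -/
theorem IsRandomSeqCompact.isStableSeqCompact {N : E → L0 P} {S : Set E}
    (h : IsRandomSeqCompact N S) : IsStableSeqCompact P (weakStable N) S := by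
  intro x hx hxS
  obtain ⟨ν, hν, z, hz, hνz⟩ := h (fun i => x (AEEqFun.const Ω i)) fun i => hxS _
  choose μ hμ using fun m => exists_eval ν m
  have hsub : IsStableSubseq (fun m => x (μ m)) x := by
    refine ⟨μ, fun A k l _ _ hkl i => ?_, fun k l hkl => ?_, fun _ => rfl⟩
    · filter_upwards [hμ l, hμ (k i), hkl i] with ω h1 h2 h3 hA
      rw [h1, h2, h3 hA]
    · filter_upwards [hμ l, hμ k, hkl, ae_all_iff.mpr hν] with ω h1 h2 h3 h4
      rw [h1, h2]
      exact strictMono_nat_of_lt_succ (f := fun i => ν i ω) h4 h3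
  refine ⟨_, hsub, z, hz, tendsto_weakStable_of_tendsto_ae (hsub.isStableSeq hx) fun f hf => ?_⟩
  have h1 : ∀ᵐ ω ∂P, ∀ i : ℕ, f (x (μ (AEEqFun.const Ω i))) ω =
      f (x (AEEqFun.const Ω (ν i ω))) ω := ae_all_iff.mpr fun i => by
    filter_upwards [hμ (AEEqFun.const Ω i), coeFn_cst (P := P) i,
      hx.eval (isLocal_linearMap f) (μ (AEEqFun.const Ω i))] with ω h1 h2 h3
    rw [h3, h1, h2]
  filter_upwards [h1, hνz f hf] with ω h2 h3
  simpa only [h2] using h3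

theorem IsStableSeqCompact.weakZero {N : E → L0 P} {S : Set E}
    (h : IsStableSeqCompact P (weakStable N) S) : IsStableSeqCompact P (weakZero N) S := by
  intro x hx hxS
  obtain ⟨y, hy, z, hz, hyz⟩ := h x hx hxS
  exact ⟨y, hy, z, hz, hyz.mono_right (nhds_topStable_le _ _)⟩

end Sequences

/-! ### From stable compactness to random subsequences -/

section CompactToSequential

variable {Ω : Type*} [MeasurableSpace Ω] {P : Measure Ω}
  {E : Type*} [AddCommGroup E] [Module (L0 P) E]

/-- Cluster points of a sequence along random indices. -/
def IsRandomClusterPt (N : E → L0 P) (x : ℕ → E) (z : E) : Prop :=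
  ∀ F : Finset (E →ₗ[L0 P] L0 P), (∀ f ∈ F, f ∈ dual N) → ∀ ε > 0, ∀ m : L0Nat P,
    ∃ k, m ≤ k ∧ ∀ᵐ ω ∂P, ∀ f ∈ F, |f z ω - f (x (k ω)) ω| < ε

theorem exists_concat_nat (A : Partition Ω) (k : ℕ → L0Nat P) :
    ∃ l : L0Nat P, IsConcat (NatEq P) A k l ∧ ∀ᵐ ω ∂P, ∃ i, ω ∈ (A.part i).1 ∧ l ω = k i ω := by
  obtain ⟨m, hm⟩ := exists_index (P := P) A
  obtain ⟨l, hl⟩ := exists_eval k m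
  refine ⟨l, fun i => ?_, ?_⟩
  · filter_upwards [hm, hl] with ω h1 h2 h3
    have : m ω = i := by
      by_contra hne
      exact Set.disjoint_left.mp (A.disjoint _ _ hne) h1 h3
    rw [h2, this]
  · filter_upwards [hm, hl] with ω h1 h2 using ⟨m ω, h1, h2⟩

/-- As `cat hE x` is stable, the concatenation of the tails beyond `m i` is the tail beyond the
concatenation of the `m i`. -/
theorem isStableFilterOn_map_cat {N : E → L0 P} (hN : IsL0Norm N) (hE : IsStableModule P E)
    {S : Set E} (hS : IsStableSet (ModEq P E) S) {x : ℕ → E} (hx : ∀ i, x i ∈ S) :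
    IsStableFilterOn (P := P) S (Filter.map (cat hE x) atTop) := by
  have hst := isStableSeq_cat hN hE x
  have hconcat : ∀ (A : Partition Ω) (k : ℕ → L0Nat P) (l : L0Nat P), IsConcat (NatEq P) A k l →
      ∀ z, IsConcat (ModEq P E) A (fun i => cat hE x (k i)) z → z = cat hE x l :=
    fun A k l hl z hz => (hE A _).unique hz (hst A k l (fun _ => trivial) trivial hl)
  refine ⟨Set.range fun m => cat hE x '' Set.Ici m, ⟨Set.range_nonempty _, ?_, ?_⟩, ?_, ?_⟩
  · rintro _ ⟨m, rfl⟩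
    refine ⟨⟨_, m, Set.mem_Ici.mpr le_rfl, rfl⟩, fun A y z hy hz => ?_⟩
    choose k hk hky using hy
    obtain rfl : y = fun i => cat hE x (k i) := funext fun i => (hky i).symm
    obtain ⟨l, hl, hl'⟩ := exists_concat_nat A k
    refine ⟨l, ?_, (hconcat A k l hl z hz).symm⟩
    rw [Set.mem_Ici, le_iff_ae]
    filter_upwards [hl', ae_all_iff.mpr fun i => le_iff_ae.mp (hk i)] with ω h1 h2
    obtain ⟨i, -, h3⟩ := h1
    exact h3 ▸ h2 i
  · intro A Z hZ
    choose m hm using hZ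
    obtain ⟨l, hl, hl'⟩ := exists_concat_nat A m
    refine ⟨l, Set.Subset.antisymm ?_ ?_⟩
    · rintro _ ⟨k, hk, rfl⟩
      -- The index `k` is known to exceed `m i` only on the i-th part; the join does so everywhere
      -- and equals `k` on that part.
      refine ⟨fun i => cat hE x (k ⊔ m i), fun i => ?_, ?_⟩
      · rw [← hm i]
        exact ⟨_, Set.mem_Ici.mpr le_sup_right, rfl⟩
      · refine hst A (fun i => k ⊔ m i) k (fun _ => trivial) trivial fun i => ?_
        filter_upwards [hl i, le_iff_ae.mp (Set.mem_Ici.mp hk), AEEqFun.coeFn_sup k (m i)] with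
          ω h1 h2 h3 hA
        rw [h3, ← h1 hA, sup_eq_left.mpr h2]
    · rintro z ⟨y, hy, hz⟩
      have hy' : ∀ i, y i ∈ cat hE x '' Set.Ici (m i) := fun i => by
        have := hy i
        rwa [← hm i] at this
      choose k hk hky using hy'
      obtain rfl : y = fun i => cat hE x (k i) := funext fun i => (hky i).symm
      obtain ⟨k', hk', hk''⟩ := exists_concat_nat A k
      refine ⟨k', ?_, (hconcat A k k' hk' z hz).symm⟩
      rw [Set.mem_Ici, le_iff_ae]
      filter_upwards [hk'', ae_all_iff.mpr fun i => le_iff_ae.mp (Set.mem_Ici.mp (hk i)),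
        ae_all_iff.mpr hl] with ω h1 h2 h3
      obtain ⟨i, hA, h4⟩ := h1
      rw [h4, h3 i hA]
      exact h2 i
  · rintro _ ⟨m, rfl⟩ _ ⟨k, -, rfl⟩
    exact cat_mem hE hS hx k
  · refine ⟨fun t => ?_⟩
    rw [(atTop_basis.map (cat hE x)).mem_iff]
    simp

theorem eventually_ae_lt_of_clusterPt {N : E → L0 P} {z : E} {G : Filter E}
    (h : @ClusterPt E (weakStable N) z G) {Z : Set E} (hZ : Z ∈ G)
    (F : Finset (E →ₗ[L0 P] L0 P)) (hF : ∀ f ∈ F, f ∈ dual N) {ε : ℝ} (hε : 0 < ε) :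
    ∃ a ∈ Z, ∀ᵐ ω ∂P, ∀ f ∈ F, |f z ω - f a ω| < ε := by
  have hr : AELt 0 (AEEqFun.const Ω ε : L0 P) := by
    filter_upwards [coeFn_zero (P := P), coeFn_cst (P := P) ε] with ω h1 h2
    rwa [h1, h2]
  have hU : (⋂ f ∈ F, seminormBall z {fun x => |f x|} (AEEqFun.const Ω ε)) ∈
      @nhds E (weakStable N) z :=
    nhds_topStable_le _ _ ((Filter.biInter_finset_mem F).mpr fun f hf =>
      seminormBall_mem_nhds (abs_mem_weakSeminorms (hF f hf)) (by simp) z hr)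
  obtain ⟨a, ha, haZ⟩ := (show (@nhds E (weakStable N) z ⊓ G).NeBot from h).nonempty_of_mem
    (inter_mem_inf hU hZ)
  refine ⟨a, haZ, (Finset.eventually_all _).mpr fun f hf => ?_⟩
  have h1 := Set.mem_iInter₂.mp ha f hf
  rw [mem_seminormBall_singleton] at h1
  filter_upwards [h1, coeFn_cst (P := P) ε, coeFn_abs (f (z - a)), coeFn_sub (f z) (f a)] with
    ω h2 h3 h4 h5
  rwa [h3, h4, map_sub, h5] at h2

theorem IsStableCompact.exists_isRandomClusterPt {N : E → L0 P} (hN : IsL0Norm N)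
    (hE : IsStableModule P E) {S : Set E} (hS : IsStableSet (ModEq P E) S)
    (h : IsStableCompact P (weakStable N) S) {x : ℕ → E} (hx : ∀ i, x i ∈ S) :
    ∃ z ∈ S, IsRandomClusterPt N x z := by
  obtain ⟨z, hz, hcl⟩ := h _ (isStableFilterOn_map_cat hN hE hS hx)
  refine ⟨z, hz, fun F hF ε hε m => ?_⟩
  obtain ⟨_, ⟨k, hk, rfl⟩, ha⟩ := eventually_ae_lt_of_clusterPt hcl
    (image_mem_map (Ici_mem_atTop m)) F hF hε
  refine ⟨k, hk, ?_⟩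
  have h1 : ∀ᵐ ω ∂P, ∀ f ∈ F, f (cat hE x k) ω = f (x (k ω)) ω :=
    (Finset.eventually_all _).mpr fun f _ => (isLocal_linearMap f).cat hE x k
  filter_upwards [ha, h1] with ω h2 h3 f hf
  rw [← h3 f hf]
  exact h2 f hf

/-- Beyond some random index the values are close to `c`, and cluster indices can be taken beyond
any random index. -/
theorem IsRandomClusterPt.eq_of_tendsto {N : E → L0 P} {x : ℕ → E} {z : E}
    (h : IsRandomClusterPt N x z) {f : E →ₗ[L0 P] L0 P} (hf : f ∈ dual N) {c : L0 P}
    (hc : ∀ᵐ ω ∂P, Tendsto (fun i => f (x i) ω) atTop (𝓝 (c ω))) : f z = c := by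
  have h1 : ∀ᵐ ω ∂P, ∀ q : ℕ, |f z ω - c ω| < 2 * (1 / ((q : ℝ) + 1)) := by
    refine ae_all_iff.mpr fun q => ?_
    have hq : (0 : ℝ) < 1 / ((q : ℝ) + 1) := Nat.one_div_pos_of_nat
    obtain ⟨m, hm⟩ := exists_nat_select (P := P)
      (p := fun k ω => ∀ i, k ≤ i → |f (x i) ω - c ω| < 1 / ((q : ℝ) + 1))
      (fun k => by
        have : {ω | ∀ i, k ≤ i → |f (x i) ω - c ω| < 1 / ((q : ℝ) + 1)} =
            ⋂ i, ⋂ (_ : k ≤ i), {ω | |f (x i) ω - c ω| < 1 / ((q : ℝ) + 1)} := by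
          ext ω
          simp
        rw [this]
        exact MeasurableSet.iInter fun i => MeasurableSet.iInter fun _ =>
          measurableSet_lt (((measurable_coe _).sub (measurable_coe _)).abs) measurable_const)
      (by
        filter_upwards [hc] with ω h1
        exact Metric.tendsto_atTop.mp h1 _ hq)
    obtain ⟨k, hk, hk'⟩ := h {f} (by simpa using hf) _ hq m
    filter_upwards [hm, hk', le_iff_ae.mp hk] with ω h2 h3 h4
    have h5 := h3 f (Finset.mem_singleton_self f)
    have h6 := h2 _ h4
    have := abs_sub_le (f z ω) (f (x (k ω)) ω) (c ω)
    linarith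
  rw [eq_iff_ae]
  filter_upwards [h1] with ω h2
  have h3 : Tendsto (fun q : ℕ => 2 * (1 / ((q : ℝ) + 1))) atTop (𝓝 (2 * 0)) :=
    tendsto_one_div_add_atTop_nhds_zero_nat.const_mul 2
  rw [mul_zero] at h3
  have h4 := ge_of_tendsto' h3 fun q => (h2 q).le
  exact sub_eq_zero.mp (abs_nonpos_iff.mp h4)

theorem IsRatClosed.sub_mem {D : Set E} (hD : IsRatClosed P D) {x y : E} (hx : x ∈ D) (hy : y ∈ D) :
    x - y ∈ D := by
  have h1 : (AEEqFun.const Ω (((-1 : ℚ) : ℝ)) : L0 P) = -1 := by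
    rw [eq_iff_ae]
    filter_upwards [coeFn_cst (P := P) (((-1 : ℚ) : ℝ)), coeFn_neg (1 : L0 P),
      coeFn_one (P := P)] with ω h1 h2 h3
    rw [h1, h2, h3]
    norm_num
  have h2 := hD.add_mem x hx _ (hD.smul_mem (-1) y hy)
  rwa [h1, neg_smul, one_smul, ← sub_eq_add_neg] at h2

variable (N : E → L0 P) in
/-- `z` is in the closure of `D`, allowing for random choices in `D`. -/
def IsRandomLimit (D : Set E) (z : E) : Prop :=
  ∀ᵐ ω ∂P, ∀ ε > 0, ∃ d ∈ D, N (z - d) ω < ε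

/-- A random Mazur theorem: a functional vanishing on `D` vanishes at `z`, and one of them detects
the distance. The hypothesis tests functionals instead of membership because random concatenations
of members of `D` need not lie in `D`. -/
theorem IsRandomClusterPt.isRandomLimit [IsProbabilityMeasure P] {N : E → L0 P} (hN : IsL0Norm N)
    {D : Set E} (hD : IsRatClosed P D) {x : ℕ → E} {z : E} (h : IsRandomClusterPt N x z)
    (hx : ∀ f : E →ₗ[L0 P] L0 P, (∀ d ∈ D, f d = 0) → ∀ i, f (x i) = 0) :
    IsRandomLimit N D z := by
  obtain ⟨f, hf, hfD, hfz⟩ := exists_separating hN hD z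
  refine hfz (h.eq_of_tendsto (dualBall_subset_dual hN hf) ?_)
  simp only [hx f hfD]
  exact Eventually.of_forall fun ω => tendsto_const_nhds

/-- Norming functionals of `D` separate the points of the closure of `D`. -/
theorem eq_of_norming {N : E → L0 P} (hN : IsL0Norm N) {D : Set E} (hD : IsRatClosed P D)
    {z w : E} (hz : IsRandomLimit N D z) (hw : IsRandomLimit N D w)
    (h : ∀ d ∈ D, ∃ f ∈ dualBall N, f d = N d ∧ f z = f w) : z = w := by
  have hsub : ∀ a b, N (a - b) ≤ N a + N b := fun a b => by
    rw [sub_eq_add_neg, ← hN.neg b]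
    exact hN.add_le a (-b)
  -- A functional that norms `d - e` and does not distinguish `z` from `w` gives `N (d - e) ≤ N ((z
  -- - d) - (w - e))`.
  have h1 : ∀ d ∈ D, ∀ e ∈ D, N (z - w) ≤ 2 * (N (z - d) + N (w - e)) := by
    intro d hd e he
    obtain ⟨f, hf, hfd, hfz⟩ := h (d - e) (hD.sub_mem hd he)
    have h2 : N (z - w) ≤ N ((z - d) - (w - e)) + N (d - e) := by
      have := hN.add_le ((z - d) - (w - e)) (d - e)
      rwa [show (z - d) - (w - e) + (d - e) = z - w by abel] at this
    have h3 : N (d - e) ≤ N ((z - d) - (w - e)) := by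
      have h4 : f (d - e) = -f ((z - d) - (w - e)) := by
        simp only [map_sub, hfz]
        ring
      rw [← hfd, h4]
      exact (neg_le_abs _).trans (hf _)
    calc N (z - w) ≤ N ((z - d) - (w - e)) + N ((z - d) - (w - e)) := h2.trans (by gcongr)
      _ ≤ (N (z - d) + N (w - e)) + (N (z - d) + N (w - e)) :=
          add_le_add (hsub _ _) (hsub _ _)
      _ = _ := by ring
  have h5 : ∀ᵐ ω ∂P, ∀ d ∈ D, ∀ e ∈ D, N (z - w) ω ≤ 2 * (N (z - d) ω + N (w - e) ω) := by
    refine (ae_ball_iff hD.countable).mpr fun d hd => (ae_ball_iff hD.countable).mpr fun e he => ?_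
    have h2 : (2 : L0 P) = 1 + 1 := by norm_num
    filter_upwards [le_iff_ae.mp (h1 d hd e he), coeFn_mul 2 (N (z - d) + N (w - e)),
      coeFn_add (N (z - d)) (N (w - e)), coeFn_add (1 : L0 P) 1, coeFn_one (P := P)] with
      ω h3 h4 h6 h7 h8
    rw [h4, h6, h2, h7, h8] at h3
    linarith
  have h6 : N (z - w) = 0 := by
    refine le_antisymm ?_ (hN.nonneg _)
    rw [le_iff_ae]
    filter_upwards [h5, hz, hw, coeFn_zero (P := P)] with ω h2 h3 h4 h7
    rw [h7]
    refine le_of_forall_pos_le_add fun ε hε => ?_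
    obtain ⟨d, hd, hd'⟩ := h3 (ε / 4) (by positivity)
    obtain ⟨e, he, he'⟩ := h4 (ε / 4) (by positivity)
    linarith [h2 d hd e he]
  exact sub_eq_zero.mp (hN.eq_zero _ h6)

theorem exists_rapid_seq {N : E → L0 P} {x : ℕ → E} {z : E} (h : IsRandomClusterPt N x z)
    (f : ℕ → E →ₗ[L0 P] L0 P) (hf : ∀ j, f j ∈ dual N) :
    ∃ κ : ℕ → L0Nat P, (∀ n, AELt (κ n) (κ (n + 1))) ∧
      ∀ᵐ ω ∂P, ∀ n j, j ≤ n → |f j z ω - f j (x (κ n ω)) ω| < 1 / ((n : ℝ) + 1) := by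
  classical
  choose K hK hK' using fun (n : ℕ) => h ((Finset.range (n + 1)).image f)
    (by
      intro g hg
      obtain ⟨j, -, rfl⟩ := Finset.mem_image.mp hg
      exact hf j) (1 / ((n : ℝ) + 1)) Nat.one_div_pos_of_nat
  let κ : ℕ → L0Nat P := fun n => Nat.rec (K 0 0) (fun n k => K (n + 1) (k + 1)) n
  have hκ : ∀ n, κ (n + 1) = K (n + 1) (κ n + 1) := fun n => rfl
  refine ⟨κ, fun n => ?_, ?_⟩
  · filter_upwards [le_iff_ae.mp (hκ n ▸ hK (n + 1) (κ n + 1)), AEEqFun.coeFn_add (κ n) 1,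
      coeFn_natOne (P := P)] with ω h1 h2 h3
    rw [h2, Pi.add_apply, h3] at h1
    exact h1
  · refine ae_all_iff.mpr fun n => ?_
    have h1 : ∃ m, κ n = K n m := by
      cases n with
      | zero => exact ⟨0, rfl⟩
      | succ n => exact ⟨_, hκ n⟩
    obtain ⟨m, hm⟩ := h1
    rw [hm]
    filter_upwards [hK' n m] with ω h2 j hj
    exact h2 _ (Finset.mem_image_of_mem _ (Finset.mem_range.mpr (Nat.lt_succ_of_le hj)))

/-- The indices are chosen to work for countably many norming functionals. For an arbitrary `f`,
elements violating convergence would have a cluster point different from `z`, although norming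
functionals identify it with `z`. -/
theorem IsStableCompact.isRandomSeqCompact [IsProbabilityMeasure P] {N : E → L0 P}
    (hN : IsL0Norm N) (hE : IsStableModule P E) {S : Set E} (hS : IsStableSet (ModEq P E) S)
    (h : IsStableCompact P (weakStable N) S) : IsRandomSeqCompact N S := by
  intro x hx
  obtain ⟨D, hD, hDx⟩ := exists_isRatClosed (P := P) (fun _ : Finset E => Set.range x)
    fun _ => Set.countable_range x
  have hxD : ∀ i, x i ∈ D := fun i => hDx ∅ (by simp) ⟨i, rfl⟩
  obtain ⟨e, he⟩ := hD.countable.exists_eq_range ⟨0, hD.zero_mem⟩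
  choose g hg hgN using fun d => exists_norming hN d
  have hgd : ∀ d, g d ∈ dual N := fun d => dualBall_subset_dual hN (hg d)
  obtain ⟨z, hz, hzcl⟩ := h.exists_isRandomClusterPt hN hE hS hx
  have hzD : IsRandomLimit N D z := hzcl.isRandomLimit hN hD fun f hf i => hf _ (hxD i)
  obtain ⟨κ, hκ, hκz⟩ := exists_rapid_seq hzcl (fun j => g (e j)) fun j => hgd _
  refine ⟨κ, hκ, z, hz, fun f hf => ?_⟩
  have hu : ∀ n, ∃ u : L0 P, ∀ᵐ ω ∂P, u ω = f (x (κ n ω)) ω := fun n =>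
    exists_eval (fun i => f (x i)) (κ n)
  choose u hu using hu
  have hmain : ∀ᵐ ω ∂P, ∀ l : ℕ, ∃ n0 : ℕ, ∀ n, n0 ≤ n →
      |f z ω - u n ω| < 1 / ((l : ℝ) + 1) := by
    refine ae_all_iff.mpr fun l => ?_
    have hl : (0 : ℝ) < 1 / ((l : ℝ) + 1) := Nat.one_div_pos_of_nat
    have hbadm : ∀ n, MeasurableSet {ω | |f z ω - u n ω| < 1 / ((l : ℝ) + 1)} := fun n =>
      measurableSet_lt (((measurable_coe _).sub (measurable_coe _)).abs) measurable_const
    -- A worst index beyond `i`: if the bound fails anywhere from `i` on, it fails at `m i`. A good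
    -- `m i` therefore certifies the whole tail.
    have hsel : ∀ i : ℕ, ∃ m : L0Nat P, ∀ᵐ ω ∂P, i ≤ m ω ∧
        (|f z ω - u (m ω) ω| < 1 / ((l : ℝ) + 1) →
          ∀ n, i ≤ n → |f z ω - u n ω| < 1 / ((l : ℝ) + 1)) := fun i => by
      refine exists_nat_select (p := fun m ω => i ≤ m ∧ (|f z ω - u m ω| < 1 / ((l : ℝ) + 1) →
          ∀ n, i ≤ n → |f z ω - u n ω| < 1 / ((l : ℝ) + 1))) (fun m => ?_)
        (Eventually.of_forall fun ω => ?_)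
      · have : {ω | i ≤ m ∧ (|f z ω - u m ω| < 1 / ((l : ℝ) + 1) →
            ∀ n, i ≤ n → |f z ω - u n ω| < 1 / ((l : ℝ) + 1))} = {_ω | i ≤ m} ∩
            ({ω | |f z ω - u m ω| < 1 / ((l : ℝ) + 1)}ᶜ ∪
              ⋂ n, ⋂ (_ : i ≤ n), {ω | |f z ω - u n ω| < 1 / ((l : ℝ) + 1)}) := by
          ext ω
          simp [imp_iff_not_or]
        rw [this]
        exact (MeasurableSet.const _).inter ((hbadm m).compl.union
          (MeasurableSet.iInter fun n => MeasurableSet.iInter fun _ => hbadm n))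
      · by_cases hω : ∀ n, i ≤ n → |f z ω - u n ω| < 1 / ((l : ℝ) + 1)
        · exact ⟨i, le_rfl, fun _ => hω⟩
        · push Not at hω
          obtain ⟨n, hn, hn'⟩ := hω
          exact ⟨n, hn, fun h => absurd h (not_lt.mpr hn')⟩
    choose m hm using hsel
    choose κ' hκ' using fun i => exists_eval κ (m i)
    have hwx : ∀ (f : E →ₗ[L0 P] L0 P) i, ∀ᵐ ω ∂P,
        f (cat hE x (κ' i)) ω = f (x (κ (m i ω) ω)) ω := fun f i => by
      filter_upwards [(isLocal_linearMap f).cat hE x (κ' i), hκ' i] with ω h1 h2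
      rw [h1, h2]
    obtain ⟨w, hw, hwcl⟩ := h.exists_isRandomClusterPt hN hE hS
      (x := fun i => cat hE x (κ' i)) fun i => cat_mem hE hS hx _
    have hwD : IsRandomLimit N D w := hwcl.isRandomLimit hN hD fun f hf i => by
      rw [eq_iff_ae]
      filter_upwards [(isLocal_linearMap f).cat hE x (κ' i)] with ω h1
      rw [h1, hf _ (hxD _)]
    -- Since `m i ≥ i`, the worst indices preserve convergence on the norming functionals.
    have hzw : w = z := eq_of_norming hN hD hwD hzD fun d hd => by
      obtain ⟨j, rfl⟩ : d ∈ Set.range e := he ▸ hd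
      refine ⟨g (e j), hg _, hgN _, hwcl.eq_of_tendsto (hgd _) ?_⟩
      filter_upwards [ae_all_iff.mpr hm, ae_all_iff.mpr (hwx (g (e j))), hκz] with ω h1 h2 h3
      rw [Metric.tendsto_atTop]
      intro ε hε
      obtain ⟨q, hq⟩ := exists_nat_one_div_lt hε
      refine ⟨max j q, fun i hi => ?_⟩
      rw [h2, Real.dist_eq, abs_sub_comm]
      refine (h3 (m i ω) j ((le_max_left j q).trans (hi.trans (h1 i).1))).trans_le ?_
      refine le_trans ?_ hq.le
      have h4 : q ≤ m i ω := (le_max_right j q).trans (hi.trans (h1 i).1)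
      exact one_div_le_one_div_of_le (by positivity) (by gcongr)
    obtain ⟨k, -, hk⟩ := hwcl {f} (by simpa using hf) _ hl 0
    filter_upwards [hk, ae_all_iff.mpr hm, ae_all_iff.mpr (hwx f), ae_all_iff.mpr hu] with
      ω h1 h2 h3 h4
    have h5 := h1 f (Finset.mem_singleton_self f)
    rw [hzw, h3, ← h4] at h5
    exact ⟨k ω, (h2 _).2 h5⟩
  filter_upwards [hmain, ae_all_iff.mpr hu] with ω h1 h2
  rw [Metric.tendsto_atTop]
  intro ε hε
  obtain ⟨l, hl⟩ := exists_nat_one_div_lt hε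
  obtain ⟨n0, hn0⟩ := h1 l
  refine ⟨n0, fun n hn => ?_⟩
  rw [Real.dist_eq, abs_sub_comm, ← h2]
  exact (hn0 n hn).trans hl

end CompactToSequential

/-! ### From random subsequences to stable compactness -/

section SequentialToCompact

variable {Ω : Type*} [MeasurableSpace Ω] {P : Measure Ω}
  {E : Type*} [AddCommGroup E] [Module (L0 P) E]

theorem le_of_forall_aeLt_succ {ν : ℕ → L0Nat P} (hν : ∀ i, AELt (ν i) (ν (i + 1))) :
    ∀ᵐ ω ∂P, ∀ i, i ≤ ν i ω := by
  filter_upwards [ae_all_iff.mpr hν] with ω h1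
  exact fun i => (strictMono_nat_of_lt_succ (f := fun i => ν i ω) h1).le_apply

/-- Members of the dual are bounded on sequentially compact sets. -/
theorem IsRandomSeqCompact.bounded [IsProbabilityMeasure P] {N : E → L0 P}
    (hE : IsStableModule P E) {S : Set E} (hS : IsStableSet (ModEq P E) S)
    (h : IsRandomSeqCompact N S) {f : E →ₗ[L0 P] L0 P} (hf : f ∈ dual N) :
    ∃ C : L0 P, ∀ x ∈ S, ∀ᵐ ω ∂P, |f x ω| ≤ C ω := by
  obtain ⟨u, huX, hu⟩ := exists_countable_exhausting (X := (fun x => |f x|) '' S) (hS.1.image _)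
  choose x hx hxu using huX
  have hxu' : ∀ᵐ ω ∂P, ∀ i, u i ω = |f (x i) ω| := ae_all_iff.mpr fun i => by
    rw [← hxu i]
    exact coeFn_abs _
  have hbdd : ∀ᵐ ω ∂P, BddAbove (Set.range fun i => u i ω) := by
    -- The index `m n` exceeds the level `n` wherever some `u i` does. Values along a convergent
    -- random subsequence are bounded, so at almost every ω some level is never exceeded.
    have hsel : ∀ n : ℕ, ∃ m : L0Nat P, ∀ᵐ ω ∂P, (n : ℝ) < u (m ω) ω ∨ ∀ j, u j ω ≤ n := fun n => by
      refine exists_nat_select (p := fun i ω => (n : ℝ) < u i ω ∨ ∀ j, u j ω ≤ n) (fun i => ?_)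
        (Eventually.of_forall fun ω => ?_)
      · have : {ω | (n : ℝ) < u i ω ∨ ∀ j, u j ω ≤ n} =
            {ω | (n : ℝ) < u i ω} ∪ ⋂ j, {ω | u j ω ≤ n} := by
          ext ω
          simp
        rw [this]
        exact (measurableSet_lt measurable_const (measurable_coe _)).union
          (MeasurableSet.iInter fun j => measurableSet_le (measurable_coe _) measurable_const)
      · by_cases hω : ∀ j, u j ω ≤ n
        · exact ⟨0, Or.inr hω⟩
        · push Not at hω
          exact hω.imp fun i hi => Or.inl hi
    choose m hm using hsel
    obtain ⟨ν, hν, z, -, hz⟩ := h (fun n => cat hE x (m n)) fun n => cat_mem hE hS hx _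
    filter_upwards [hz f hf, le_of_forall_aeLt_succ hν, ae_all_iff.mpr hm, hxu',
      ae_all_iff.mpr fun n => (isLocal_linearMap f).cat hE x (m n)] with ω h1 h2 h3 h4 h5
    by_contra hω
    obtain ⟨b, hb⟩ := h1.norm.bddAbove_range
    obtain ⟨n, hn⟩ := exists_nat_gt b
    have h6 := hb ⟨n, rfl⟩
    simp only [Real.norm_eq_abs] at h6
    rw [h5, ← h4] at h6
    have h7 : (n : ℝ) ≤ ν n ω := by exact_mod_cast h2 n
    rcases h3 (ν n ω) with h8 | h8
    · linarith
    · exact hω ⟨_, Set.forall_mem_range.mpr h8⟩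
  obtain ⟨C, hC⟩ := exists_mk (P := P) (Measurable.iSup fun i => measurable_coe (u i))
  refine ⟨C, fun y hy => ?_⟩
  filter_upwards [hC, hbdd, hu _ ⟨y, hy, rfl⟩, coeFn_abs (f y)] with ω h1 h2 h3 h4
  simp only [h4] at h3
  rw [h1]
  refine le_of_forall_pos_lt_add fun ε hε => ?_
  obtain ⟨i, hi⟩ := h3 ε hε
  have := le_ciSup h2 i
  linarith

/-- The members of `Z` that take prescribed values up to an error. -/
def approxSet (Z : Set E) (Γ : Finset ((E →ₗ[L0 P] L0 P) × L0 P)) (ε : ℝ) : Set E :=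
  {a | a ∈ Z ∧ ∀ᵐ ω ∂P, ∀ p ∈ Γ, |p.1 a ω - p.2 ω| < ε}

theorem cat_mem_approxSet (hE : IsStableModule P E) {Z : Set E} (hZ : IsStableSet (ModEq P E) Z)
    {Γ : Finset ((E →ₗ[L0 P] L0 P) × L0 P)} {ε : ℝ} {a : ℕ → E} (ha : ∀ i, a i ∈ approxSet Z Γ ε)
    (m : L0Nat P) : cat hE a m ∈ approxSet Z Γ ε := by
  refine ⟨cat_mem hE hZ (fun i => (ha i).1) m, (Finset.eventually_all _).mpr fun p hp => ?_⟩
  filter_upwards [(isLocal_linearMap p.1).cat hE a m, ae_all_iff.mpr fun i => (ha i).2] with ω h1 h2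
  rw [h1]
  exact h2 _ p hp

theorem approxSet_mono {Z Z' : Set E} (hZ : Z ⊆ Z') {Γ Γ' : Finset ((E →ₗ[L0 P] L0 P) × L0 P)}
    (hΓ : Γ' ⊆ Γ) {ε ε' : ℝ} (hε : ε ≤ ε') : approxSet Z Γ ε ⊆ approxSet Z' Γ' ε' := by
  rintro a ⟨ha, ha'⟩
  refine ⟨hZ ha, ?_⟩
  filter_upwards [ha'] with ω h1 p hp using (h1 p (hΓ hp)).trans_le hε

/-- Approximation sets are closed under random choices, so pointwise near-maximisers glue to one
element. -/
theorem exists_isLUB_approxSet [IsProbabilityMeasure P] (hE : IsStableModule P E) {Z : Set E}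
    (hZ : IsStableSet (ModEq P E) Z) {Γ : Finset ((E →ₗ[L0 P] L0 P) × L0 P)} {ε : ℝ}
    (hne : (approxSet Z Γ ε).Nonempty) {f : E →ₗ[L0 P] L0 P} {C : L0 P}
    (hC : ∀ x ∈ Z, ∀ᵐ ω ∂P, |f x ω| ≤ C ω) :
    ∃ s, IsLUB (f '' approxSet Z Γ ε) s ∧
      ∀ δ > 0, ∃ a ∈ approxSet Z Γ ε, ∀ᵐ ω ∂P, s ω - δ < f a ω := by
  obtain ⟨s, hs, u, huX, hu⟩ := exists_isLUB_L0 (hne.image f) ⟨C, by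
    rintro _ ⟨a, ha, rfl⟩
    rw [le_iff_ae]
    filter_upwards [hC a ha.1] with ω h1 using (le_abs_self _).trans h1⟩
  choose a ha hau using huX
  refine ⟨s, hs, fun δ hδ => ?_⟩
  obtain ⟨m, hm⟩ := exists_nat_select (P := P) (p := fun i ω => s ω - δ < u i ω)
    (fun i => measurableSet_lt ((measurable_coe _).sub_const _) (measurable_coe _))
    (by filter_upwards [hu] with ω h1 using h1 δ hδ)
  refine ⟨cat hE a m, cat_mem_approxSet hE hZ ha m, ?_⟩
  filter_upwards [hm, (isLocal_linearMap f).cat hE a m] with ω h1 h2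
  rw [h2, hau]
  exact h1

/-- Prescribed values of functionals that are approximately attained on all members of `ℬ`. -/
def IsConsistent (ℬ : Set (Set E)) (G : Set ((E →ₗ[L0 P] L0 P) × L0 P)) : Prop :=
  ∀ Γ : Finset ((E →ₗ[L0 P] L0 P) × L0 P), ↑Γ ⊆ G → ∀ Z ∈ ℬ, ∀ ε > 0, (approxSet Z Γ ε).Nonempty

/-- The value `c` is a limit superior of `f`: the essential infimum of its essential suprema over
base sets under the earlier constraints. Such suprema are at least `c`, which gives points with `f`
above `c - ε`; suprema close to `c`, selected at random, bound `f` from above. -/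
theorem IsConsistent.exists_insert [IsProbabilityMeasure P] (hE : IsStableModule P E) {S : Set E}
    {ℬ : Set (Set E)} (hne : ℬ.Nonempty) (hst : ∀ Z ∈ ℬ, IsStableSet (ModEq P E) Z)
    (hℬS : ∀ Z ∈ ℬ, Z ⊆ S) (hdir : ∀ Z ∈ ℬ, ∀ Z' ∈ ℬ, ∃ Z'' ∈ ℬ, Z'' ⊆ Z ∩ Z')
    {G : Set ((E →ₗ[L0 P] L0 P) × L0 P)} (hG : IsConsistent ℬ G) {f : E →ₗ[L0 P] L0 P} {C : L0 P}
    (hC : ∀ x ∈ S, ∀ᵐ ω ∂P, |f x ω| ≤ C ω) : ∃ c, IsConsistent ℬ (insert (f, c) G) := by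
  classical
  have hCZ : ∀ Z ∈ ℬ, ∀ x ∈ Z, ∀ᵐ ω ∂P, |f x ω| ≤ C ω := fun Z hZ x hx => hC x (hℬS Z hZ hx)
  let X : Set (L0 P) := {s | ∃ Γ : Finset ((E →ₗ[L0 P] L0 P) × L0 P), ↑Γ ⊆ G ∧ ∃ Z ∈ ℬ, ∃ ε > 0,
    IsLUB (f '' approxSet Z Γ ε) s}
  have hXne : X.Nonempty := by
    obtain ⟨Z, hZ⟩ := hne
    have hΓ : ↑(∅ : Finset ((E →ₗ[L0 P] L0 P) × L0 P)) ⊆ G := by simp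
    obtain ⟨s, hs, -⟩ := exists_isLUB_approxSet hE (hst Z hZ) (hG ∅ hΓ Z hZ 1 one_pos) (hCZ Z hZ)
    exact ⟨s, ∅, hΓ, Z, hZ, 1, one_pos, hs⟩
  have hXb : BddBelow X := by
    refine ⟨-C, ?_⟩
    rintro s ⟨Γ, hΓ, Z, hZ, ε, hε, hs⟩
    obtain ⟨a, ha⟩ := hG Γ hΓ Z hZ ε hε
    refine le_trans ?_ (hs.1 ⟨a, ha, rfl⟩)
    rw [le_iff_ae]
    filter_upwards [hCZ Z hZ a ha.1, coeFn_neg C] with ω h1 h2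
    rw [h2]
    exact (abs_le.mp h1).1
  obtain ⟨c, hc, s, hsX, hs⟩ := exists_isGLB_L0 hXne hXb
  refine ⟨c, fun Γ' hΓ' Z hZ ε hε => ?_⟩
  have hΓ : ↑(Γ'.erase (f, c)) ⊆ G := fun p hp => by
    rw [Finset.mem_coe, Finset.mem_erase] at hp
    exact (hΓ' hp.2).resolve_left hp.1
  have hstep : ∀ i, ∃ a ∈ approxSet Z (Γ'.erase (f, c)) ε,
      ∀ᵐ ω ∂P, c ω - ε < f a ω ∧ f a ω ≤ s i ω := by
    intro i
    obtain ⟨Γ₁, hΓ₁, Z₁, hZ₁, ε₁, hε₁, hs₁⟩ := hsX i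
    obtain ⟨Z₂, hZ₂, hsub⟩ := hdir Z hZ Z₁ hZ₁
    have hΓ₂ : ↑(Γ'.erase (f, c) ∪ Γ₁) ⊆ G := by
      rw [Finset.coe_union]
      exact Set.union_subset hΓ hΓ₁
    have hε₂ : 0 < min ε ε₁ := lt_min hε hε₁
    obtain ⟨t, ht, hta⟩ := exists_isLUB_approxSet hE (hst Z₂ hZ₂) (hG _ hΓ₂ Z₂ hZ₂ _ hε₂)
      (hCZ Z₂ hZ₂)
    obtain ⟨a, ha, hta⟩ := hta ε hε
    refine ⟨a, approxSet_mono (hsub.trans Set.inter_subset_left) Finset.subset_union_left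
      (min_le_left _ _) ha, ?_⟩
    have h1 : f a ≤ s i := hs₁.1 ⟨a, approxSet_mono (hsub.trans Set.inter_subset_right)
      Finset.subset_union_right (min_le_right _ _) ha, rfl⟩
    have h2 : c ≤ t := hc.1 ⟨_, hΓ₂, Z₂, hZ₂, _, hε₂, ht⟩
    filter_upwards [le_iff_ae.mp h1, le_iff_ae.mp h2, hta] with ω h3 h4 h5
    exact ⟨by linarith, h3⟩
  choose a ha haf using hstep
  obtain ⟨m, hm⟩ := exists_nat_select (P := P) (p := fun i ω => s i ω < c ω + ε)
    (fun i => measurableSet_lt (measurable_coe _) ((measurable_coe _).add_const _))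
    (by filter_upwards [hs] with ω h1 using h1 ε hε)
  obtain ⟨h1, h2⟩ := cat_mem_approxSet hE (hst Z hZ) ha m
  refine ⟨cat hE a m, h1, ?_⟩
  filter_upwards [h2, hm, (isLocal_linearMap f).cat hE a m, ae_all_iff.mpr haf] with ω h3 h4 h5 h6
  intro p hp
  by_cases hpf : p = (f, c)
  · subst hpf
    simp only
    have h7 := h6 (m ω)
    rw [h5, abs_lt]
    constructor <;> linarith [h7.1, h7.2]
  · exact h3 p (Finset.mem_erase.mpr ⟨hpf, hp⟩)

/-- All functionals can be assigned consistent values. -/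
theorem exists_consistent_values [IsProbabilityMeasure P] (hE : IsStableModule P E) {S : Set E}
    {ℬ : Set (Set E)} (hne : ℬ.Nonempty) (hst : ∀ Z ∈ ℬ, IsStableSet (ModEq P E) Z)
    (hℬS : ∀ Z ∈ ℬ, Z ⊆ S) (hdir : ∀ Z ∈ ℬ, ∀ Z' ∈ ℬ, ∃ Z'' ∈ ℬ, Z'' ⊆ Z ∩ Z')
    {B : Set (E →ₗ[L0 P] L0 P)} (hB : ∀ f ∈ B, ∃ C : L0 P, ∀ x ∈ S, ∀ᵐ ω ∂P, |f x ω| ≤ C ω) :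
    ∃ φ : (E →ₗ[L0 P] L0 P) → L0 P, ∀ F : Finset (E →ₗ[L0 P] L0 P), (∀ f ∈ F, f ∈ B) →
      ∀ Z ∈ ℬ, ∀ ε > 0, ∃ a ∈ Z, ∀ᵐ ω ∂P, ∀ f ∈ F, |f a ω - φ f ω| < ε := by
  classical
  -- Consistency concerns finitely many pairs at a time, so Teichmüller–Tukey applies; a maximal
  -- family contains a value for every `f` in `B`.
  have hfc : Order.IsOfFiniteCharacter {G | IsConsistent (P := P) ℬ G} := fun G => by
    refine ⟨fun hG y hy _ Γ hΓ => hG Γ (hΓ.trans hy), fun hG Γ hΓ => ?_⟩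
    exact hG Γ hΓ Γ.finite_toSet Γ subset_rfl
  have hempty : IsConsistent (P := P) ℬ ∅ := fun Γ hΓ Z hZ ε _ => by
    obtain ⟨a, ha⟩ := (hst Z hZ).1
    refine ⟨a, ha, Eventually.of_forall fun ω p hp => absurd (hΓ hp) (Set.notMem_empty p)⟩
  obtain ⟨G, -, hG, hmax⟩ := hfc.exists_maximal hempty
  have hφ : ∀ f, ∃ c, f ∈ B → (f, c) ∈ G := fun f => by
    by_cases hf : f ∈ B
    · obtain ⟨C, hC⟩ := hB f hf
      obtain ⟨c, hc⟩ := IsConsistent.exists_insert hE hne hst hℬS hdir hG hC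
      exact ⟨c, fun _ => hmax hc (Set.subset_insert _ _) (Set.mem_insert _ _)⟩
    · exact ⟨0, fun h => absurd h hf⟩
  choose φ hφ using hφ
  refine ⟨φ, fun F hF Z hZ ε hε => ?_⟩
  obtain ⟨a, haZ, ha⟩ := hG (F.image fun f => (f, φ f)) (fun p hp => by
    obtain ⟨f, hf, rfl⟩ := Finset.mem_image.mp (Finset.mem_coe.mp hp)
    exact hφ f (hF f hf)) Z hZ ε hε
  refine ⟨a, haZ, ?_⟩
  filter_upwards [ha] with ω h1 f hf
  exact h1 _ (Finset.mem_image_of_mem _ hf)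

/-- Values of the functionals in the dual unit ball that are approximated on `S` are attained. -/
theorem IsRandomSeqCompact.exists_eval_eq [IsProbabilityMeasure P] {N : E → L0 P} (hN : IsL0Norm N)
    {S : Set E} (h : IsRandomSeqCompact N S) {φ : (E →ₗ[L0 P] L0 P) → L0 P}
    (hφ : ∀ F : Finset (E →ₗ[L0 P] L0 P), (∀ f ∈ F, f ∈ dualBall N) →
      ∀ ε > 0, ∃ a ∈ S, ∀ᵐ ω ∂P, ∀ f ∈ F, |f a ω - φ f ω| < ε) :
    ∃ z ∈ S, ∀ f ∈ dualBall N, φ f = f z := by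
  classical
  have h0 : (0 : E →ₗ[L0 P] L0 P) ∈ dualBall N := fun x => by
    rw [LinearMap.zero_apply, abs_zero]
    exact hN.nonneg x
  -- For each `d`, countably many functionals exhaust the essential supremum of `|φ f - f d|` over
  -- the dual ball.
  have hG : ∀ d : E, ∃ g : ℕ → E →ₗ[L0 P] L0 P, (∀ i, g i ∈ dualBall N) ∧
      ∀ f ∈ dualBall N, ∀ᵐ ω ∂P, ∀ ε > 0, ∃ i,
        |φ f ω - f d ω| - ε < |φ (g i) ω - g i d ω| := fun d => by
    obtain ⟨u, huX, hu⟩ := exists_countable_exhausting (P := P)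
      (X := (fun f : E →ₗ[L0 P] L0 P => |φ f - f d|) '' dualBall N) ⟨_, 0, h0, rfl⟩
    choose g hg hgu using huX
    have habs : ∀ f : E →ₗ[L0 P] L0 P, ∀ᵐ ω ∂P,
        (|φ f - f d| : L0 P) ω = |φ f ω - f d ω| := fun f => by
      filter_upwards [coeFn_abs (φ f - f d), coeFn_sub (φ f) (f d)] with ω h1 h2
      rw [h1, h2]
    refine ⟨g, hg, fun f hf => ?_⟩
    filter_upwards [hu _ ⟨f, hf, rfl⟩, habs f, ae_all_iff.mpr fun i => habs (g i)] with
      ω h1 h2 h3 ε hε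
    obtain ⟨i, hi⟩ := h1 ε hε
    simp only [← hgu] at hi
    exact ⟨i, by rwa [h2, h3] at hi⟩
  choose G hGB hG using hG
  have hpick : ∀ (F : Finset (E →ₗ[L0 P] L0 P)) (n : ℕ), ∃ a ∈ S, (∀ f ∈ F, f ∈ dualBall N) →
      ∀ᵐ ω ∂P, ∀ f ∈ F, |f a ω - φ f ω| < 1 / ((n : ℝ) + 1) := fun F n => by
    by_cases hF : ∀ f ∈ F, f ∈ dualBall N
    · obtain ⟨a, haS, ha⟩ := hφ F hF (1 / ((n : ℝ) + 1)) Nat.one_div_pos_of_nat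
      exact ⟨a, haS, fun _ => ha⟩
    · obtain ⟨a, haS, -⟩ := hφ ∅ (by simp) 1 one_pos
      exact ⟨a, haS, fun h => absurd h hF⟩
  choose pick hpickS hpick using hpick
  -- `D` is closed off so that points of `S` picked to approximate `φ` on finitely many functionals
  -- attached to `D` lie in `D` again.
  obtain ⟨D, hD, hDT⟩ := exists_isRatClosed (P := P)
    (fun F : Finset E => ⋃ n, (fun Γ => pick Γ n) ''
      {Γ : Finset (E →ₗ[L0 P] L0 P) | ↑Γ ⊆ ⋃ d ∈ F, Set.range (G d)})
    fun F => Set.countable_iUnion fun n => (countable_finset_subset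
      (F.countable_toSet.biUnion fun d _ => Set.countable_range (G d))).image _
  have hΦ : (⋃ d ∈ D, Set.range (G d)).Countable :=
    hD.countable.biUnion fun d _ => Set.countable_range (G d)
  obtain ⟨e, he⟩ := hΦ.exists_eq_range
    ⟨G 0 0, Set.mem_biUnion hD.zero_mem (Set.mem_range_self 0)⟩
  have heD : ∀ j, ∃ d ∈ D, e j ∈ Set.range (G d) := fun j => by
    have : e j ∈ ⋃ d ∈ D, Set.range (G d) := he ▸ Set.mem_range_self j
    simpa using this
  choose d hdD hed using heD
  have heB : ∀ j, e j ∈ dualBall N := fun j => by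
    obtain ⟨i, hi⟩ := hed j
    exact hi ▸ hGB _ i
  let a : ℕ → E := fun n => pick ((Finset.range (n + 1)).image e) n
  have haD : ∀ n, a n ∈ D := fun n => by
    refine hDT ((Finset.range (n + 1)).image d) (fun x hx => ?_)
      (Set.mem_iUnion.mpr ⟨n, _, ?_, rfl⟩)
    · obtain ⟨j, -, rfl⟩ := Finset.mem_image.mp (Finset.mem_coe.mp hx)
      exact hdD j
    · intro f hf
      obtain ⟨j, hj, rfl⟩ := Finset.mem_image.mp (Finset.mem_coe.mp hf)
      exact Set.mem_biUnion (Finset.mem_coe.mpr (Finset.mem_image_of_mem d hj)) (hed j)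
  have ha : ∀ᵐ ω ∂P, ∀ n j, j ≤ n → |e j (a n) ω - φ (e j) ω| < 1 / ((n : ℝ) + 1) := by
    refine ae_all_iff.mpr fun n => ?_
    have h1 := hpick ((Finset.range (n + 1)).image e) n (fun f hf => by
      obtain ⟨j, -, rfl⟩ := Finset.mem_image.mp hf
      exact heB j)
    filter_upwards [h1] with ω h2 j hj
    exact h2 _ (Finset.mem_image_of_mem _ (Finset.mem_range.mpr (Nat.lt_succ_of_le hj)))
  obtain ⟨ν, hν, z, hz, hzν⟩ := h a fun n => hpickS _ _
  have hez : ∀ j, ∀ᵐ ω ∂P, e j z ω = φ (e j) ω := fun j => by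
    filter_upwards [ha, le_of_forall_aeLt_succ hν,
      hzν (e j) (dualBall_subset_dual hN (heB j))] with ω h1 h2 h3
    refine tendsto_nhds_unique h3 (Metric.tendsto_atTop.mpr fun ε hε => ?_)
    obtain ⟨q, hq⟩ := exists_nat_one_div_lt hε
    refine ⟨max j q, fun i hi => ?_⟩
    rw [Real.dist_eq]
    refine (h1 (ν i ω) j ((le_max_left j q).trans (hi.trans (h2 i)))).trans_le ?_
    refine le_trans ?_ hq.le
    have h4 : q ≤ ν i ω := (le_max_right j q).trans (hi.trans (h2 i))
    exact one_div_le_one_div_of_le (by positivity) (by gcongr)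
  have hzD : IsRandomLimit N D z := by
    obtain ⟨f, hf, hfD, hfz⟩ := exists_separating hN hD z
    refine hfz (eq_iff_ae.mpr ?_)
    filter_upwards [hzν f (dualBall_subset_dual hN hf), coeFn_zero (P := P)] with ω h1 h2
    simp only [hfD _ (haD _), h2] at h1
    rw [h2]
    exact (tendsto_nhds_unique h1 tendsto_const_nhds)
  refine ⟨z, hz, fun f hf => eq_iff_ae.mpr ?_⟩
  -- On the countable family `φ` agrees with evaluation at `z`, so each `|φ (G d i) - G d i d|` is
  -- at most `N (z - d)`; exhaustion carries this over to every `f`.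
  have hmain : ∀ᵐ ω ∂P, ∀ d ∈ D, |φ f ω - f d ω| ≤ N (z - d) ω := by
    refine (ae_ball_iff hD.countable).mpr fun d hd => ?_
    have h1 : ∀ᵐ ω ∂P, ∀ i, |φ (G d i) ω - G d i d ω| ≤ N (z - d) ω := by
      refine ae_all_iff.mpr fun i => ?_
      obtain ⟨j, hj⟩ : G d i ∈ Set.range e := he ▸ Set.mem_biUnion hd (Set.mem_range_self i)
      filter_upwards [hez j, dualBall_sub_ae (heB j) z d] with ω h2 h3
      rw [← hj, ← h2]
      exact h3
    filter_upwards [h1, hG d f hf] with ω h2 h3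
    refine le_of_forall_pos_lt_add fun ε hε => ?_
    obtain ⟨i, hi⟩ := h3 ε hε
    linarith [h2 i]
  have hfz : ∀ᵐ ω ∂P, ∀ d ∈ D, |f z ω - f d ω| ≤ N (z - d) ω :=
    (ae_ball_iff hD.countable).mpr fun d _ => dualBall_sub_ae hf z d
  filter_upwards [hmain, hfz, hzD] with ω h1 h2 h3
  refine eq_of_abs_sub_le_all fun ε hε => ?_
  obtain ⟨d, hd, hd'⟩ := h3 (ε / 2) (half_pos hε)
  have h4 := abs_sub_le (φ f ω) (f d ω) (f z ω)
  rw [abs_sub_comm (f d ω)] at h4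
  linarith [h1 d hd, h2 d hd]

/-- Stable sets meet the neighbourhoods of the points that they approximate on the dual unit
ball. -/
theorem exists_mem_of_mem_nhds_weakStable {N : E → L0 P} (hN : IsL0Norm N) (hE : IsStableModule P E)
    {Z : Set E} (hZ : IsStableSet (ModEq P E) Z) {z : E}
    (h : ∀ F : Finset (E →ₗ[L0 P] L0 P), (∀ f ∈ F, f ∈ dualBall N) →
      ∀ ε > 0, ∃ a ∈ Z, ∀ᵐ ω ∂P, ∀ f ∈ F, |f a ω - f z ω| < ε) {U : Set E}
    (hU : U ∈ @nhds E (weakStable N) z) : ∃ a ∈ Z, a ∈ U := by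
  classical
  obtain ⟨F, n, r, hF, hr, hFU⟩ := exists_of_mem_nhds_weakStable hU
  choose! g hg C hC hgC using fun f (hf : f ∈ dual N) => exists_dualBall_of_mem_dual hN hf
  choose b hbZ hb using fun k l : ℕ => h ((F k).image g) (fun f hf => by
    obtain ⟨f', hf', rfl⟩ := Finset.mem_image.mp hf
    exact hg f' (hF k f' hf')) (1 / ((l : ℝ) + 1)) Nat.one_div_pos_of_nat
  -- The index encodes the local family in force at ω and an accuracy fine enough to absorb the
  -- factors `C f`.
  obtain ⟨m, hm⟩ := exists_nat_select (P := P)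
    (p := fun i ω => n ω = i.unpair.1 ∧
      ∀ f ∈ F i.unpair.1, C f ω * (1 / ((i.unpair.2 : ℝ) + 1)) < r ω)
    (fun i => by
      have : {ω | n ω = i.unpair.1 ∧
            ∀ f ∈ F i.unpair.1, C f ω * (1 / ((i.unpair.2 : ℝ) + 1)) < r ω} =
          {ω | n ω = i.unpair.1} ∩
            ⋂ f ∈ F i.unpair.1, {ω | C f ω * (1 / ((i.unpair.2 : ℝ) + 1)) < r ω} := by
        ext ω
        simp
      rw [this]
      exact (measurable_coe_nat n (measurableSet_singleton _)).inter
        (Finset.measurableSet_biInter _ fun f _ =>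
          measurableSet_lt ((measurable_coe _).mul_const _) (measurable_coe _)))
    (by
      filter_upwards [hr, coeFn_zero (P := P)] with ω h1 h2
      rw [h2] at h1
      have h3 : ∀ᶠ l : ℕ in atTop, ∀ f ∈ F (n ω), C f ω * (1 / ((l : ℝ) + 1)) < r ω := by
        refine (Finset.eventually_all _).mpr fun f _ => ?_
        have h4 : Tendsto (fun l : ℕ => C f ω * (1 / ((l : ℝ) + 1))) atTop (𝓝 (C f ω * 0)) :=
          tendsto_one_div_add_atTop_nhds_zero_nat.const_mul _
        rw [mul_zero] at h4
        exact h4.eventually_lt_const h1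
      obtain ⟨l, hl⟩ := h3.exists
      refine ⟨Nat.pair (n ω) l, ?_⟩
      simpa using hl)
  refine ⟨cat hE (fun i => b i.unpair.1 i.unpair.2) m, cat_mem hE hZ (fun i => hbZ _ _) m,
    hFU _ ?_⟩
  have h1 : ∀ᵐ ω ∂P, ∀ k, ∀ f ∈ F k, (0 < C f ω ∧ f z ω = C f ω * g f z ω) ∧
      f (cat hE (fun i => b i.unpair.1 i.unpair.2) m) ω =
        C f ω * g f (b (m ω).unpair.1 (m ω).unpair.2) ω := by
    refine ae_all_iff.mpr fun k => (Finset.eventually_all _).mpr fun f hf => ?_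
    filter_upwards [hC f (hF k f hf), coeFn_zero (P := P), hgC f (hF k f hf) z,
      ae_all_iff.mpr fun i : ℕ => hgC f (hF k f hf) (b i.unpair.1 i.unpair.2),
      (isLocal_linearMap f).cat hE (fun i => b i.unpair.1 i.unpair.2) m] with ω h1 h2 h3 h4 h5
    rw [h2] at h1
    exact ⟨⟨h1, h3⟩, by rw [h5, h4]⟩
  filter_upwards [h1, hm, ae_all_iff.mpr fun k => ae_all_iff.mpr fun l => hb k l] with
    ω h2 h3 h4 f hf
  obtain ⟨⟨h5, h6⟩, h7⟩ := h2 _ f hf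
  obtain ⟨h8, h9⟩ := h3
  rw [h8] at hf
  have h10 := h4 (m ω).unpair.1 (m ω).unpair.2 _ (Finset.mem_image_of_mem g hf)
  rw [h6, h7, ← mul_sub, abs_mul, abs_of_pos h5, abs_sub_comm]
  exact (mul_lt_mul_of_pos_left h10 h5).trans (h9 f hf)

/-- One base set suffices to represent `φ` by a point `z`; since `φ` is approximated on all base
sets, each of them meets every neighbourhood of `z`. -/
theorem IsRandomSeqCompact.isStableCompact [IsProbabilityMeasure P] {N : E → L0 P}
    (hN : IsL0Norm N) (hE : IsStableModule P E) {S : Set E} (hS : IsStableSet (ModEq P E) S)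
    (h : IsRandomSeqCompact N S) : IsStableCompact P (weakStable N) S := by
  rintro G ⟨ℬ, ⟨hne, hst, -⟩, hℬS, hbasis⟩
  have hdir : ∀ Z ∈ ℬ, ∀ Z' ∈ ℬ, ∃ Z'' ∈ ℬ, Z'' ⊆ Z ∩ Z' := fun Z hZ Z' hZ' =>
    hbasis.mem_iff.mp (inter_mem (hbasis.mem_of_mem hZ) (hbasis.mem_of_mem hZ'))
  obtain ⟨φ, hφ⟩ := exists_consistent_values hE hne hst hℬS hdir (B := dualBall N)
    fun f hf => h.bounded hE hS (dualBall_subset_dual hN hf)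
  obtain ⟨Z₀, hZ₀⟩ := hne
  obtain ⟨z, hz, hφz⟩ := h.exists_eval_eq hN (φ := φ) fun F hF ε hε => by
    obtain ⟨a, ha, ha'⟩ := hφ F hF Z₀ hZ₀ ε hε
    exact ⟨a, hℬS Z₀ hZ₀ ha, ha'⟩
  refine ⟨z, hz, inf_neBot_iff.mpr fun {U} hU {V} hV => ?_⟩
  obtain ⟨Z, hZ, hZV⟩ := hbasis.mem_iff.mp hV
  obtain ⟨a, haZ, haU⟩ := exists_mem_of_mem_nhds_weakStable hN hE (hst Z hZ) (z := z)
    (fun F hF ε hε => by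
      obtain ⟨a, ha, ha'⟩ := hφ F hF Z hZ ε hε
      refine ⟨a, ha, ?_⟩
      filter_upwards [ha'] with ω h1 f hf
      rw [← hφz f (hF f hf)]
      exact h1 f hf) hU
  exact ⟨a, haU, hZV haZ⟩

end SequentialToCompact

end L0Mod

theorem mainTheorem6 {Ω : Type*} [MeasurableSpace Ω] (P : Measure Ω) [IsProbabilityMeasure P]
    {E : Type*} [AddCommGroup E] [Module (L0Mod.L0 P) E]
    (hE : L0Mod.IsStableModule P E)
    (N : E → L0Mod.L0 P) (hN : L0Mod.IsL0Norm N)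
    (S : Set E) (hS : L0Mod.IsStableSet (L0Mod.ModEq P E) S) :
    List.TFAE [
      L0Mod.IsStableCompact P (L0Mod.weakStable N) S,
      L0Mod.IsStableSeqCompact P (L0Mod.weakZero N) S,
      L0Mod.IsStableSeqCompact P (L0Mod.weakStable N) S] := by
  tfae_have 1 → 3 := fun h => (h.isRandomSeqCompact hN hE hS).isStableSeqCompact
  tfae_have 3 → 2 := fun h => h.weakZero
  tfae_have 2 → 1 := fun h => (h.isRandomSeqCompact hN hE hS).isStableCompact hN hE hS
  tfae_finish
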